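/- Let $\mathbb D$ be the open unit disk. A self-map of $\mathbb D$ is an analytic function $f$ on $\mathbb D$ with $f(\mathbb D)\subset\mathbb D$; a linear fractional map is a map $z\mapsto (az+b)/(cz+d)$ with $ad-bc\ne 0$. A self-map other than the identity is elliptic if it has a fixed point in $\mathbb D$; otherwise its iterates converge, uniformly on compact subsets of $\mathbb D$, to a point $p\in\partial\mathbb D$ (its Denjoy--Wolff point), and it is hyperbolic if the angular derivative satisfies $f'(p)<1$ and parabolic if $f'(p)=1$. A semigroup of self-maps of $\mathbb D$ is a family $\{g_t\}_{t\in[0,\infty)}$ of self-maps of $\mathbb D$ with $g_0=\mathrm{id}_{\mathbb D}$, $g_s\circ g_t=g_{s+t}$ for all $s,t\ge 0$, and $g_s\to g_t$ uniformly on compact subsets of $\mathbb D$ as $s\to t$, for every $t\ge 0$. For $p\in\mathbb D$ let $\varphi_p(z)=(p-z)/(1-\overline p z)$. (i) Given a parabolic or hyperbolic linear fractional self-map $\varphi$ of $\mathbb D$ and a number $s>0$, there is a unique semigroup $\{g_t\}_{t\in[0,\infty)}$ of self-maps of $\mathbb D$ such that $g_s=\varphi$. Every elliptic automorphism of $\mathbb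 D$ is a member of some semigroup of self-maps of $\mathbb D$, which is not necessarily unique: there are an elliptic automorphism $\varphi$, a number $s>0$ and two different semigroups $\{g_t\}$, $\{h_t\}$ with $g_s=h_s=\varphi$. (ii) Let $\varphi$ be an elliptic linear fractional self-map of $\mathbb D$ that is not an automorphism. If $p\in\mathbb D$ is its fixed point, then $\varphi_p\circ\varphi\circ\varphi_p$ has the form $z\mapsto \dfrac{Az}{Cz+1}$ with $A,C\in\mathbb C$, $|A|+|C|\le 1$ and $A\ne 1$. Whenever $\varphi$ is conjugate, by an automorphism of $\mathbb D$, to a map $z\mapsto \dfrac{Az}{Cz+1}$ with $|A|+|C|\le 1$, the map $\varphi$ belongs to some semigroup of self-maps of $\mathbb D$ if and only if there is a sequence $(a_n)_{n\ge 0}$ of complex numbers such that $a_0=A$, $a_n^2=a_{n-1}$ for every $n\ge 1$, and all $a_n$ belong to the region $$S=\left\{z\in\mathbb D : \frac{|C|}{|1-A|}\,|1-z|\le 1-|z|\right\}.$$ -/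

import Mathlib

open Set Filter Topology
open scoped NNReal ComplexConjugate

namespace DiskDynamics

/-- The open unit disk. -/
def disk : Set ℂ := Metric.ball 0 1

/-- `f` restricts to an analytic self-map of the unit disk. Maps of the disk are represented by
functions on `ℂ`; only their values on the disk matter in every definition below. -/
structure IsSelfMap (f : ℂ → ℂ) : Prop where
  differentiableOn : DifferentiableOn ℂ f disk
  mapsTo : MapsTo f disk disk

/-- `f` agrees on the disk with a linear fractional transformation without pole in the disk. -/
def IsLFT (f : ℂ → ℂ) : Prop :=
  ∃ a b c d : ℂ, a * d - b * c ≠ 0 ∧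
    ∀ z ∈ disk, c * z + d ≠ 0 ∧ f z = (a * z + b) / (c * z + d)

/-- Disk automorphism: a bijective analytic self-map of the disk. -/
structure IsDiskAut (f : ℂ → ℂ) : Prop where
  isSelfMap : IsSelfMap f
  bijOn : BijOn f disk disk

/-- The non-tangential approach region in the disk with vertex `p` and aperture `M`. -/
def approachRegion (p : ℂ) (M : ℝ) : Set ℂ :=
  {z | z ∈ disk ∧ ‖z - p‖ ≤ M * (1 - ‖z‖)}

/-- `F` has angular (non-tangential) limit `l` at the boundary point `p`. -/
def HasAngularLimit (F : ℂ → ℂ) (p l : ℂ) : Prop :=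
  ∀ M : ℝ, Tendsto F (𝓝[approachRegion p M] p) (𝓝 l)

/-- `p` is a Denjoy-Wolff point of `f` on the unit circle: the iterates of `f` converge to `p`
uniformly on compact subsets of the disk (so that `f` has no fixed point in the disk). -/
def IsBoundaryDenjoyWolffPoint (f : ℂ → ℂ) (p : ℂ) : Prop :=
  ‖p‖ = 1 ∧ ∀ K ⊆ disk, IsCompact K →
    TendstoUniformlyOn (fun n : ℕ => f^[n]) (fun _ => p) atTop K

/-- `f` has the Denjoy-Wolff point `p` on the unit circle and its angular derivative there is
the real number `α`. -/
def HasBoundaryMultiplier (f : ℂ → ℂ) (p : ℂ) (α : ℝ) : Prop :=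
  IsBoundaryDenjoyWolffPoint f p ∧ HasAngularLimit (fun z => (f z - p) / (z - p)) p (α : ℂ)

/-- Elliptic self-map: not the identity of the disk, with a fixed point in the disk. -/
def IsElliptic (f : ℂ → ℂ) : Prop :=
  IsSelfMap f ∧ ¬ EqOn f id disk ∧ ∃ p ∈ disk, f p = p

/-- Hyperbolic self-map: Denjoy-Wolff point on the circle, angular derivative less than one. -/
def IsHyperbolic (f : ℂ → ℂ) : Prop :=
  IsSelfMap f ∧ ∃ p : ℂ, ∃ α : ℝ, HasBoundaryMultiplier f p α ∧ α < 1

/-- Parabolic self-map: Denjoy-Wolff point on the circle, angular derivative equal to one. -/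
def IsParabolic (f : ℂ → ℂ) : Prop :=
  IsSelfMap f ∧ ∃ p : ℂ, HasBoundaryMultiplier f p 1

/-- A (strongly continuous, one-parameter) semigroup of analytic self-maps of the disk, indexed
by `t ∈ [0, ∞)`. -/
structure IsSemigroup (g : ℝ≥0 → ℂ → ℂ) : Prop where
  isSelfMap : ∀ t, IsSelfMap (g t)
  zero : EqOn (g 0) id disk
  add : ∀ s t, EqOn (g s ∘ g t) (g (s + t)) disk
  strongly_continuous : ∀ t, ∀ K ⊆ disk, IsCompact K → TendstoUniformlyOn g (g t) (𝓝 t) K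

/-- `f` is a member of some semigroup of analytic self-maps of the disk. -/
def BelongsToSemigroup (f : ℂ → ℂ) : Prop :=
  ∃ g : ℝ≥0 → ℂ → ℂ, IsSemigroup g ∧ ∃ t : ℝ≥0, EqOn (g t) f disk

/-- The involutive disk automorphism that interchanges `p` and `0`. -/
noncomputable def involution (p z : ℂ) : ℂ := (p - z) / (1 - conj p * z)

/-- The map `z ↦ A z / (C z + 1)`. -/
noncomputable def normalForm (A C z : ℂ) : ℂ := A * z / (C * z + 1)

/-- The region `{z ∈ 𝔻 : (|C| / |1 - A|) |1 - z| ≤ 1 - |z|}` with vertex `1`. -/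
def stolzRegion (A C : ℂ) : Set ℂ :=
  {z | z ∈ disk ∧ ‖C‖ / ‖1 - A‖ * ‖1 - z‖ ≤ 1 - ‖z‖}

end DiskDynamics

/-!
Everything rests on conjugating the given map to a simple model and on elementary consequences of
the Schwarz lemma.

*Parabolic and hyperbolic maps.* Sending the Denjoy–Wolff point to infinity turns the map into `T
w = l w + b` on the right half-plane, with `l ≥ 1` the reciprocal of the angular derivative and
`Re b ≥ 0` (`exists_affine_model`). The real powers of `T` give a semigroup. For uniqueness, let
`H` be a holomorphic self-map commuting with `T`. The Schwarz–Pick inequality at the points `Tⁿ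
w₁`, `Tⁿ w₂` becomes, as `n → ∞`, an inequality for a geometry that `T` preserves: the hyperbolic
metric of a larger half-plane if `l > 1`, the Euclidean metric if `l = 1` and `Re b > 0`. Since
`H` is a contraction for it and commutes with `T`, it must act along one orbit line of the real
powers of `T` in the same way as a dilation (`eq_dilation_of_commute`) or a translation
(`eq_translation_of_commute`), and the identity theorem extends this to the half-plane. If `T` is
a translation by a purely imaginary number, its commutant is larger, but Schwarz–Pick still shows
that `H` does not decrease the real part; as the members of a semigroup through `T` compose to
powers of `T`, they preserve it (`IsHalfPlaneSemigroup.eq_translation`). The parameters of these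
dilations or translations depend continuously and additively on time, hence linearly.

*Elliptic automorphisms.* They are conjugate to rotations, and a rotation can be reached by
turning in either direction.

*Other elliptic maps.* Put `k = C / (1 - A)`. The function `κ z = z / (1 + k z)` linearizes `A z /
(C z + 1)`, and it linearizes every self-map `h` commuting with it: the quotient `κ (h z) / κ z`
is invariant, so it equals its limit along an orbit that tends to `0` (`koenigs_of_commute`). Thus
`h` is the normal form with multiplier `λ = h' 0` and second coefficient `k (1 - λ)`, and it maps
the disk to itself exactly when `|k| |1 - λ| ≤ 1 - |λ|` (`norm_add_norm_le_one_iff`). The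
multipliers of the members `g (t / 2ⁿ)` of a semigroup are therefore square roots as required.
Conversely, successive square roots in this region tend to `1`, hence are eventually principal
roots and are interpolated by one exponential `exp (t μ)`; the region is closed and stable under
products, so it contains `exp (t μ)` for all `t ≥ 0`, by density of the dyadic numbers
(`exists_exp_of_square_roots`).
-/

namespace DiskDynamics

/-! ### Conformal equivalences and semiflows -/

/-- `σ` maps `U` biholomorphically onto `V`, with inverse `τ`; the values of `σ` off `U` and of
`τ` off `V` are irrelevant. -/
structure IsConformalEquiv (U V : Set ℂ) (σ τ : ℂ → ℂ) : Prop where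
  differentiableOn : DifferentiableOn ℂ σ U
  differentiableOn_inv : DifferentiableOn ℂ τ V
  mapsTo : MapsTo σ U V
  mapsTo_inv : MapsTo τ V U
  leftInvOn : LeftInvOn τ σ U
  rightInvOn : LeftInvOn σ τ V

namespace IsConformalEquiv

variable {U V W : Set ℂ} {σ τ σ' τ' : ℂ → ℂ}

theorem symm (h : IsConformalEquiv U V σ τ) : IsConformalEquiv V U τ σ :=
  ⟨h.2, h.1, h.4, h.3, h.6, h.5⟩

theorem trans (h : IsConformalEquiv U V σ τ) (h' : IsConformalEquiv V W σ' τ') :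
    IsConformalEquiv U W (σ' ∘ σ) (τ ∘ τ') where
  differentiableOn := h'.differentiableOn.comp h.differentiableOn h.mapsTo
  differentiableOn_inv := h.differentiableOn_inv.comp h'.differentiableOn_inv h'.mapsTo_inv
  mapsTo := h'.mapsTo.comp h.mapsTo
  mapsTo_inv := h.mapsTo_inv.comp h'.mapsTo_inv
  leftInvOn z hz := by
    simp [h'.leftInvOn (h.mapsTo hz), h.leftInvOn hz]
  rightInvOn z hz := by
    simp [h.rightInvOn (h'.mapsTo_inv hz), h'.rightInvOn hz]

theorem bijOn (h : IsConformalEquiv U V σ τ) : BijOn σ U V :=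
  InvOn.bijOn ⟨h.leftInvOn, h.rightInvOn⟩ h.mapsTo h.mapsTo_inv

end IsConformalEquiv

theorem isOpen_disk : IsOpen disk := Metric.isOpen_ball

theorem mem_disk {z : ℂ} : z ∈ disk ↔ ‖z‖ < 1 := mem_ball_zero_iff

theorem zero_mem_disk : (0 : ℂ) ∈ disk := by simp [mem_disk]

theorem isConnected_disk : IsConnected disk := Metric.isConnected_ball one_pos

theorem IsConformalEquiv.isDiskAut {σ τ : ℂ → ℂ} (h : IsConformalEquiv disk disk σ τ) :
    IsDiskAut σ :=
  ⟨⟨h.differentiableOn, h.mapsTo⟩, h.bijOn⟩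

/-- The inverse of an injective holomorphic function is holomorphic: it is continuous by the open
mapping theorem, and differentiable wherever the derivative of the function does not vanish; the
zeros of that derivative are isolated, hence removable. -/
theorem isConformalEquiv_of_bijOn {U V : Set ℂ} {σ τ : ℂ → ℂ} (hU : IsOpen U)
    (hσ : DifferentiableOn ℂ σ U) (hb : BijOn σ U V) (hl : LeftInvOn τ σ U) :
    IsConformalEquiv U V σ τ := by
  have hr : LeftInvOn σ τ V := by
    intro w hw
    obtain ⟨z, hz, rfl⟩ := hb.surjOn hw
    rw [hl hz]
  have hτ : MapsTo τ V U := by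
    intro w hw
    obtain ⟨z, hz, rfl⟩ := hb.surjOn hw
    rwa [hl hz]
  have hA : AnalyticOnNhd ℂ σ U := hσ.analyticOnNhd hU
  have hopen : ∀ z ∈ U, 𝓝 (σ z) ≤ map σ (𝓝 z) := by
    intro z hz
    refine (hA z hz).eventually_constant_or_nhds_le_map_nhds.resolve_left fun hc => ?_
    have h1 : ∀ᶠ y in 𝓝 z, y = z := by
      filter_upwards [hc, hU.mem_nhds hz] with y hy hyU using hb.injOn hyU hz hy
    have h2 : ∀ᶠ y in 𝓝[≠] z, False := by
      filter_upwards [h1.filter_mono nhdsWithin_le_nhds, self_mem_nhdsWithin] with y hy hy'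
      exact hy' hy
    simpa using h2.exists
  have hVn : ∀ w ∈ V, V ∈ 𝓝 w := by
    intro w hw
    obtain ⟨z, hz, rfl⟩ := hb.surjOn hw
    exact hopen z hz (mem_map.2 (mem_of_superset (hU.mem_nhds hz) hb.mapsTo))
  have hV : IsOpen V := isOpen_iff_mem_nhds.2 hVn
  have hcont : ∀ w ∈ V, ContinuousAt τ w := by
    intro w hw
    obtain ⟨z, hz, rfl⟩ := hb.surjOn hw
    refine Tendsto.mono_left ?_ (hopen z hz)
    rw [hl hz, tendsto_map'_iff]
    refine tendsto_id.congr' ?_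
    filter_upwards [hU.mem_nhds hz] with y hy using (hl hy).symm
  refine ⟨hσ, ?_, hb.mapsTo, hτ, hl, hr⟩
  intro w hw
  have hz : τ w ∈ U := hτ hw
  have hder : ∀ᶠ y in 𝓝[≠] (τ w), deriv σ y ≠ 0 := by
    refine (hA _ hz).deriv.eventually_eq_zero_or_eventually_ne_zero.resolve_left fun h0 => ?_
    obtain ⟨ε, hε, hball⟩ := Metric.mem_nhds_iff.1 (inter_mem h0 (hU.mem_nhds hz))
    have hconst : ∀ y ∈ Metric.ball (τ w) ε, σ y = σ (τ w) := fun y hy =>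
      Metric.isOpen_ball.is_const_of_deriv_eq_zero (Metric.isPreconnected_ball)
        (hσ.mono fun x hx => (hball hx).2) (fun x hx => (hball hx).1) hy
        (Metric.mem_ball_self hε)
    have h2 : ∀ᶠ y in 𝓝[≠] (τ w), False := by
      filter_upwards [mem_nhdsWithin_of_mem_nhds (Metric.ball_mem_nhds (τ w) hε),
        self_mem_nhdsWithin] with y hy hy'
      exact hy' (hb.injOn (hball hy).2 hz (hconst y hy))
    simpa using h2.exists
  have hev : ∀ᶠ y in 𝓝[≠] w, DifferentiableAt ℂ τ y := by
    have h1 : Tendsto τ (𝓝[≠] w) (𝓝[≠] (τ w)) := by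
      refine tendsto_nhdsWithin_iff.2 ⟨(hcont w hw).mono_left nhdsWithin_le_nhds, ?_⟩
      filter_upwards [mem_nhdsWithin_of_mem_nhds (hVn w hw), self_mem_nhdsWithin]
        with y hy hyw hyw'
      exact hyw (by rw [mem_singleton_iff, ← hr hy, mem_singleton_iff.1 hyw', hr hw])
    filter_upwards [h1.eventually hder, mem_nhdsWithin_of_mem_nhds (hVn w hw)] with y hy hyV
    exact (HasDerivAt.of_local_left_inverse (hcont y hyV)
      ((hσ.differentiableAt (hU.mem_nhds (hτ hyV))).hasDerivAt) hy
      (by filter_upwards [hVn y hyV] with x hx using hr hx)).differentiableAt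
  exact (Complex.analyticAt_of_differentiable_on_punctured_nhds_of_continuousAt hev
    (hcont w hw)).differentiableAt.differentiableWithinAt

theorem IsDiskAut.exists_isConformalEquiv {σ : ℂ → ℂ} (h : IsDiskAut σ) :
    ∃ τ, IsConformalEquiv disk disk σ τ :=
  ⟨_, isConformalEquiv_of_bijOn isOpen_disk h.isSelfMap.differentiableOn h.bijOn
    h.bijOn.injOn.leftInvOn_invFunOn⟩

/-- A jointly continuous semigroup, indexed by `[0, ∞)`, of holomorphic self-maps of `V`. -/
structure IsSemiflow (V : Set ℂ) (G : ℝ≥0 → ℂ → ℂ) : Prop where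
  differentiableOn : ∀ t, DifferentiableOn ℂ (G t) V
  mapsTo : ∀ t, MapsTo (G t) V V
  zero : EqOn (G 0) id V
  add : ∀ s t, EqOn (G s ∘ G t) (G (s + t)) V
  continuousOn : ContinuousOn (Function.uncurry G) (univ ×ˢ V)

/-- Conjugation by a conformal equivalence turns a semiflow on `V` into a semigroup of self-maps
of the disk. -/
theorem IsSemiflow.isSemigroup {V : Set ℂ} {G : ℝ≥0 → ℂ → ℂ} {σ τ : ℂ → ℂ}
    (hG : IsSemiflow V G) (h : IsConformalEquiv disk V σ τ) :
    IsSemigroup (fun t => τ ∘ G t ∘ σ) where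
  isSelfMap t := ⟨h.differentiableOn_inv.comp
      ((hG.differentiableOn t).comp h.differentiableOn h.mapsTo) ((hG.mapsTo t).comp h.mapsTo),
    h.mapsTo_inv.comp ((hG.mapsTo t).comp h.mapsTo)⟩
  zero z hz := by simp [hG.zero (h.mapsTo hz), h.leftInvOn hz]
  add s t z hz := by
    have h1 := hG.mapsTo t (h.mapsTo hz)
    have h2 := hG.add s t (h.mapsTo hz)
    simp only [Function.comp_apply] at h2 ⊢
    rw [h.rightInvOn h1, h2]
  strongly_continuous t K hK hKc := by
    have hcont : ContinuousOn (Function.uncurry fun (t : ℝ≥0) => τ ∘ G t ∘ σ) (univ ×ˢ K) := by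
      have h1 : ContinuousOn (fun p : ℝ≥0 × ℂ => (p.1, σ p.2)) (univ ×ˢ K) :=
        continuousOn_fst.prodMk (h.differentiableOn.continuousOn.comp continuousOn_snd
          fun p hp => hK hp.2)
      have h2 : ContinuousOn (fun p : ℝ≥0 × ℂ => G p.1 (σ p.2)) (univ ×ˢ K) :=
        hG.continuousOn.comp h1 fun p hp => ⟨trivial, h.mapsTo (hK hp.2)⟩
      exact h.differentiableOn_inv.continuousOn.comp h2
        fun p hp => hG.mapsTo p.1 (h.mapsTo (hK hp.2))
    intro u hu
    obtain ⟨v, hv, hvu⟩ := hKc.mem_uniformity_of_prod hcont (mem_univ t)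
      (symm_le_uniformity hu)
    rw [nhdsWithin_univ] at hv
    filter_upwards [hv] with s hs z hz using hvu s hs z hz

/-! ### Möbius maps between the disk and half-planes -/

/-- The right half-plane. -/
def rightHalfPlane : Set ℂ := {w | 0 < w.re}

theorem isOpen_rightHalfPlane : IsOpen rightHalfPlane :=
  isOpen_lt continuous_const Complex.continuous_re

theorem convex_rightHalfPlane : Convex ℝ rightHalfPlane :=
  convex_halfSpace_re_gt 0

theorem one_mem_rightHalfPlane : (1 : ℂ) ∈ rightHalfPlane := by simp [rightHalfPlane]

/-- Cayley transform of the right half-plane onto the disk that sends `a` to `0`. -/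
noncomputable def cayley (a w : ℂ) : ℂ := (w - a) / (w + conj a)

/-- Inverse of the Cayley transform `cayley a`. -/
noncomputable def cayleyInv (a z : ℂ) : ℂ := (a + conj a * z) / (1 - z)

theorem one_sub_ne_zero_of_mem_disk {z : ℂ} (hz : z ∈ disk) : 1 - z ≠ 0 := by
  rw [mem_disk] at hz
  intro h
  rw [← sub_eq_zero.1 h] at hz
  simp at hz

theorem add_conj_ne_zero {w a : ℂ} (hw : w ∈ rightHalfPlane) (ha : a ∈ rightHalfPlane) :
    w + conj a ≠ 0 := by
  intro h
  have := congrArg Complex.re h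
  simp [rightHalfPlane] at this hw ha
  linarith

theorem isConformalEquiv_cayley {a : ℂ} (ha : a ∈ rightHalfPlane) :
    IsConformalEquiv rightHalfPlane disk (cayley a) (cayleyInv a) where
  differentiableOn := by
    unfold cayley
    exact DifferentiableOn.div (by fun_prop) (by fun_prop) fun w hw => add_conj_ne_zero hw ha
  differentiableOn_inv := by
    unfold cayleyInv
    exact DifferentiableOn.div (by fun_prop) (by fun_prop)
      fun z hz => one_sub_ne_zero_of_mem_disk hz
  mapsTo w hw := by
    have h0 := add_conj_ne_zero hw ha
    rw [mem_disk, cayley, norm_div, div_lt_one (norm_pos_iff.2 h0)]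
    refine lt_of_pow_lt_pow_left₀ 2 (norm_nonneg _) ?_
    simp only [rightHalfPlane, mem_ofPred_eq] at hw ha
    rw [← Complex.normSq_eq_norm_sq, ← Complex.normSq_eq_norm_sq, Complex.normSq_apply,
      Complex.normSq_apply]
    simp
    nlinarith [mul_pos hw ha]
  mapsTo_inv z hz := by
    have h0 := one_sub_ne_zero_of_mem_disk hz
    have h1 : 0 < Complex.normSq (1 - z) := Complex.normSq_pos.2 h0
    have hz' : Complex.normSq z < 1 := by
      rw [Complex.normSq_eq_norm_sq]
      rw [mem_disk] at hz
      nlinarith [norm_nonneg z]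
    simp only [rightHalfPlane, mem_ofPred_eq, cayleyInv] at ha ⊢
    rw [Complex.div_re, ← add_div]
    refine div_pos ?_ h1
    rw [Complex.normSq_apply] at hz'
    simp
    nlinarith
  leftInvOn w hw := by
    have h0 := add_conj_ne_zero hw ha
    have h2 := add_conj_ne_zero ha ha
    have h3 : 1 - (w - a) / (w + conj a) ≠ 0 := by
      rw [one_sub_div h0]
      refine div_ne_zero ?_ h0
      convert h2 using 1
      ring
    rw [cayley, cayleyInv, div_eq_iff h3]
    field_simp
    ring
  rightInvOn z hz := by
    have h0 := one_sub_ne_zero_of_mem_disk hz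
    have h2 := add_conj_ne_zero ha ha
    have h3 : (a + conj a * z) / (1 - z) + conj a ≠ 0 := by
      rw [div_add' _ _ _ h0]
      refine div_ne_zero ?_ h0
      convert h2 using 1
      ring
    rw [cayley, cayleyInv, div_eq_iff h3]
    field_simp
    ring

theorem isConformalEquiv_mul {ω : ℂ} (hω : ‖ω‖ = 1) :
    IsConformalEquiv disk disk (fun z => ω * z) (fun z => ω⁻¹ * z) := by
  have h0 : ω ≠ 0 := norm_ne_zero_iff.1 (by simp [hω])
  refine ⟨by fun_prop, by fun_prop, ?_, ?_, ?_, ?_⟩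
  · intro z hz; simpa [mem_disk, hω] using hz
  · intro z hz; simpa [mem_disk, hω] using hz
  · intro z _; simp [h0]
  · intro z _; simp [h0]

theorem one_sub_conj_mul_ne_zero {p z : ℂ} (hp : p ∈ disk) (hz : z ∈ disk) :
    1 - conj p * z ≠ 0 := by
  refine one_sub_ne_zero_of_mem_disk ?_
  rw [mem_disk] at *
  rw [norm_mul, RCLike.norm_conj]
  nlinarith [norm_nonneg p, norm_nonneg z]

theorem isConformalEquiv_involution {p : ℂ} (hp : p ∈ disk) :
    IsConformalEquiv disk disk (involution p) (involution p) := by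
  have hd : DifferentiableOn ℂ (involution p) disk := by
    unfold involution
    exact DifferentiableOn.div (by fun_prop) (by fun_prop)
      fun z hz => one_sub_conj_mul_ne_zero hp hz
  have hm : MapsTo (involution p) disk disk := by
    intro z hz
    have h0 := one_sub_conj_mul_ne_zero hp hz
    rw [mem_disk, involution, norm_div, div_lt_one (norm_pos_iff.2 h0)]
    refine lt_of_pow_lt_pow_left₀ 2 (norm_nonneg _) ?_
    have hp' : Complex.normSq p < 1 := by
      rw [Complex.normSq_eq_norm_sq]; rw [mem_disk] at hp; nlinarith [norm_nonneg p]
    have hz' : Complex.normSq z < 1 := by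
      rw [Complex.normSq_eq_norm_sq]; rw [mem_disk] at hz; nlinarith [norm_nonneg z]
    rw [← Complex.normSq_eq_norm_sq, ← Complex.normSq_eq_norm_sq]
    rw [Complex.normSq_apply] at *
    rw [Complex.normSq_apply] at *
    simp
    nlinarith [mul_pos (sub_pos.2 hp') (sub_pos.2 hz')]
  have hi : LeftInvOn (involution p) (involution p) disk := by
    intro z hz
    have h0 := one_sub_conj_mul_ne_zero hp hz
    have h1 := one_sub_conj_mul_ne_zero hp (hm hz)
    have h2 : p - z = involution p z * (1 - conj p * z) := (div_mul_cancel₀ _ h0).symm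
    rw [involution, div_eq_iff h1]
    linear_combination h2
  exact ⟨hd, hd, hm, hm, hi, hi⟩

theorem involution_zero (p : ℂ) : involution p 0 = p := by simp [involution]

theorem involution_self (p : ℂ) : involution p p = 0 := by simp [involution]

/-! ### The Schwarz–Pick inequality -/

/-- The Schwarz–Pick inequality in the right half-plane, in a form free of denominators. -/
theorem schwarzPick_rightHalfPlane {H : ℂ → ℂ} (hd : DifferentiableOn ℂ H rightHalfPlane)
    (hm : MapsTo H rightHalfPlane rightHalfPlane) {w₁ w₂ : ℂ} (h₁ : w₁ ∈ rightHalfPlane)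
    (h₂ : w₂ ∈ rightHalfPlane) :
    ‖H w₁ - H w₂‖ * ‖w₁ + conj w₂‖ ≤ ‖w₁ - w₂‖ * ‖H w₁ + conj (H w₂)‖ := by
  have e := isConformalEquiv_cayley h₂
  have e' := isConformalEquiv_cayley (hm h₂)
  have hF := e'.differentiableOn.comp (hd.comp e.differentiableOn_inv e.mapsTo_inv)
    (hm.comp e.mapsTo_inv)
  have hFm := (e'.mapsTo.comp (hm.comp e.mapsTo_inv)).mono_right
    (Metric.ball_subset_closedBall (α := ℂ))
  have hz := e.mapsTo h₁
  have h0 : (cayley (H w₂) ∘ H ∘ cayleyInv w₂) 0 = 0 := by simp [cayley, cayleyInv]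
  have key := Complex.norm_le_norm_of_mapsTo_ball hF hFm h0 (mem_disk.1 hz)
  simp only [Function.comp_apply, e.leftInvOn h₁] at key
  rwa [cayley, cayley, norm_div, norm_div, div_le_div_iff₀
    (norm_pos_iff.2 (add_conj_ne_zero (hm h₁) (hm h₂)))
    (norm_pos_iff.2 (add_conj_ne_zero h₁ h₂))] at key

/-- Identity theorem along a segment. -/
theorem eqOn_of_eqOn_segment {U : Set ℂ} {f g : ℂ → ℂ} (hU : IsOpen U) (hc : IsPreconnected U)
    (hf : DifferentiableOn ℂ f U) (hg : DifferentiableOn ℂ g U) {z b : ℂ} (hz : z ∈ U)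
    (hb : b ≠ 0) (h : ∀ τ : ℝ, 0 < τ → τ < 1 → f (z + τ * b) = g (z + τ * b)) : EqOn f g U := by
  refine (hf.analyticOnNhd hU).eqOn_of_preconnected_of_frequently_eq (hg.analyticOnNhd hU) hc hz ?_
  have ht : Tendsto (fun τ : ℝ => z + τ * b) (𝓝[>] 0) (𝓝[≠] z) := by
    refine tendsto_nhdsWithin_iff.2 ⟨?_, ?_⟩
    · have : Continuous fun τ : ℝ => z + τ * b := by fun_prop
      simpa using (this.tendsto 0).mono_left nhdsWithin_le_nhds
    · filter_upwards [self_mem_nhdsWithin] with τ hτ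
      have : (τ : ℂ) ≠ 0 := Complex.ofReal_ne_zero.2 (ne_of_gt hτ)
      simp [this, hb]
  refine ht.frequently (Eventually.frequently ?_)
  filter_upwards [Ioo_mem_nhdsGT (zero_lt_one' ℝ)] with τ hτ using h τ hτ.1 hτ.2

/-! ### Self-maps of the half-plane commuting with an affine map -/

section Dilation

variable {H : ℂ → ℂ} {l : ℝ} {c : ℂ}

theorem dilation_mem_rightHalfPlane (hl : 1 ≤ l) (hc : 0 ≤ c.re) {w : ℂ}
    (hw : w ∈ rightHalfPlane) : l * (w + c) - c ∈ rightHalfPlane := by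
  simp only [rightHalfPlane, mem_ofPred_eq] at *
  simp
  nlinarith [mul_nonneg (sub_nonneg.2 hl) (add_nonneg hw.le hc)]

theorem commute_dilation_pow (hl : 1 ≤ l) (hc : 0 ≤ c.re)
    (hcomm : ∀ w ∈ rightHalfPlane, H (l * (w + c) - c) = l * (H w + c) - c) (n : ℕ) {w : ℂ}
    (hw : w ∈ rightHalfPlane) :
    H ((l ^ n : ℝ) * (w + c) - c) = (l ^ n : ℝ) * (H w + c) - c := by
  induction n with
  | zero => simp
  | succ n ih =>
    have h := hcomm _ (dilation_mem_rightHalfPlane (one_le_pow₀ hl (n := n)) hc hw)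
    rw [ih] at h
    convert h using 2 <;> push_cast <;> ring

/-- Applying the Schwarz–Pick inequality far out along the orbits of the dilation with centre `-c`
shows that a map commuting with it contracts the hyperbolic metric of the larger half-plane
`Re w > -Re c`, on which the dilation is an isometry. -/
theorem schwarzPick_of_commute_dilation (hd : DifferentiableOn ℂ H rightHalfPlane)
    (hm : MapsTo H rightHalfPlane rightHalfPlane) (hl : 1 < l) (hc : 0 ≤ c.re)
    (hcomm : ∀ w ∈ rightHalfPlane, H (l * (w + c) - c) = l * (H w + c) - c)
    {w₁ w₂ : ℂ} (h₁ : w₁ ∈ rightHalfPlane) (h₂ : w₂ ∈ rightHalfPlane) :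
    ‖H w₁ - H w₂‖ * ‖(w₁ + c) + conj (w₂ + c)‖ ≤
      ‖w₁ - w₂‖ * ‖(H w₁ + c) + conj (H w₂ + c)‖ := by
  have hε : Tendsto (fun n : ℕ => (((l ^ n : ℝ)⁻¹ : ℝ) : ℂ)) atTop (𝓝 0) := by
    have := (tendsto_inv_atTop_zero.comp (tendsto_pow_atTop_atTop_of_one_lt hl))
    exact_mod_cast (Complex.continuous_ofReal.tendsto 0).comp this
  have hlim : ∀ x y : ℂ, Tendsto (fun n : ℕ => ‖x‖ * ‖y - (((l ^ n : ℝ)⁻¹ : ℝ) : ℂ) *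
      (c + conj c)‖) atTop (𝓝 (‖x‖ * ‖y‖)) := by
    intro x y
    simpa using ((tendsto_const_nhds (x := y)).sub (hε.mul_const (c + conj c))).norm.const_mul ‖x‖
  refine le_of_tendsto_of_tendsto' (hlim _ _) (hlim _ _) fun n => ?_
  have hln : 0 < l ^ n := pow_pos (by linarith) n
  have key := schwarzPick_rightHalfPlane hd hm
    (dilation_mem_rightHalfPlane (one_le_pow₀ hl.le (n := n)) hc h₁)
    (dilation_mem_rightHalfPlane (one_le_pow₀ hl.le (n := n)) hc h₂)
  rw [commute_dilation_pow hl.le hc hcomm n h₁, commute_dilation_pow hl.le hc hcomm n h₂] at key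
  have hnorm : ∀ x : ℂ, l ^ n * ‖x‖ = ‖((l ^ n : ℝ) : ℂ) * x‖ := fun x => by
    rw [norm_mul, Complex.norm_real, Real.norm_of_nonneg hln.le]
  have e1 : ∀ x y : ℂ, ‖((l ^ n : ℝ) * (x + c) - c) - ((l ^ n : ℝ) * (y + c) - c)‖
      = l ^ n * ‖x - y‖ := by
    intro x y
    rw [hnorm]
    congr 1
    ring
  have e2 : ∀ x y : ℂ, ‖((l ^ n : ℝ) * (x + c) - c) + conj ((l ^ n : ℝ) * (y + c) - c)‖
      = l ^ n * ‖(x + c) + conj (y + c) - (((l ^ n : ℝ)⁻¹ : ℝ) : ℂ) * (c + conj c)‖ := by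
    intro x y
    rw [hnorm]
    congr 1
    have : ((l ^ n : ℝ) : ℂ) ≠ 0 := Complex.ofReal_ne_zero.2 hln.ne'
    simp only [map_sub, map_mul, map_add, Complex.conj_ofReal, Complex.ofReal_inv]
    field_simp
    ring
  rw [e1, e1, e2, e2] at key
  have h2 : 0 < l ^ n * l ^ n := mul_pos hln hln
  refine le_of_mul_le_mul_left ?_ h2
  linarith

/-- A self-map commuting with a dilation is itself a dilation with the same centre. On the real ray
issuing from the centre the Schwarz–Pick inequality between a point and its image under the
dilation is tight, which makes the map real there; along the ray `H (r) / r` is then both monotone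
and periodic under `r ↦ l r`, hence constant. -/
theorem eq_dilation_of_commute (hd : DifferentiableOn ℂ H rightHalfPlane)
    (hm : MapsTo H rightHalfPlane rightHalfPlane) (hl : 1 < l) (hc : 0 ≤ c.re)
    (hcomm : ∀ w ∈ rightHalfPlane, H (l * (w + c) - c) = l * (H w + c) - c) :
    ∃ L : ℝ, 0 < L ∧ ∀ w ∈ rightHalfPlane, H w = L * (w + c) - c := by
  have hmem : ∀ r : ℝ, c.re < r → (r : ℂ) - c ∈ rightHalfPlane := by
    intro r hr
    simpa [rightHalfPlane] using hr
  have hpos : ∀ r : ℝ, c.re < r → 0 < (H (r - c) + c).re := by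
    intro r hr
    have := hm (hmem r hr)
    simp only [rightHalfPlane, mem_ofPred_eq] at this
    simp only [Complex.add_re]
    linarith
  have hpow : ∀ (r : ℝ) (n : ℕ), c.re < r →
      H (((l ^ n * r : ℝ) : ℂ) - c) + c = (l ^ n : ℝ) * (H (r - c) + c) := by
    intro r n hr
    have := commute_dilation_pow hl.le hc hcomm n (hmem r hr)
    rw [sub_add_cancel, ← Complex.ofReal_mul] at this
    rw [this]
    ring
  have him : ∀ r : ℝ, c.re < r → (H (r - c) + c).im = 0 := by
    intro r hr
    have hr0 : 0 < r := hc.trans_lt hr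
    have hlr : c.re < l ^ 1 * r := by nlinarith
    have key := schwarzPick_of_commute_dilation hd hm hl hc hcomm (hmem _ hlr) (hmem r hr)
    have hp := hpow r 1 hr
    rw [show H ((l ^ 1 * r : ℝ) - c) - H (r - c) =
      (H ((l ^ 1 * r : ℝ) - c) + c) - (H (r - c) + c) by ring, hp] at key
    generalize H (r - c) + c = v at key
    simp only [pow_one, sub_add_cancel, Complex.conj_ofReal] at key
    have e1 : ‖(l : ℂ) * v - v‖ = (l - 1) * ‖v‖ := by
      rw [show (l : ℂ) * v - v = ((l - 1 : ℝ) : ℂ) * v by push_cast; ring, norm_mul,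
        Complex.norm_real, Real.norm_of_nonneg (by linarith)]
    have e2 : ‖(((l * r : ℝ) : ℂ)) + r‖ = (l + 1) * r := by
      rw [← Complex.ofReal_add, Complex.norm_real, Real.norm_of_nonneg (by positivity)]
      ring
    have e3 : ‖(((l * r : ℝ) : ℂ) - c) - (r - c)‖ = (l - 1) * r := by
      rw [show (((l * r : ℝ) : ℂ) - c) - (r - c) = (((l - 1) * r : ℝ) : ℂ) by push_cast; ring,
        Complex.norm_real, Real.norm_of_nonneg (mul_nonneg (by linarith) hr0.le)]
    rw [e1, e2, e3] at key
    have hk : (l + 1) * ‖v‖ ≤ ‖l * v + conj v‖ := by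
      have : 0 < (l - 1) * r := mul_pos (by linarith) hr0
      refine le_of_mul_le_mul_left ?_ this
      linarith
    have hk2 := pow_le_pow_left₀ (by positivity) hk 2
    rw [mul_pow, ← Complex.normSq_eq_norm_sq, ← Complex.normSq_eq_norm_sq, Complex.normSq_apply,
      Complex.normSq_apply] at hk2
    simp at hk2
    have h4 : 4 * l * (v.im * v.im) ≤ 0 := by nlinarith
    have h5 : v.im * v.im ≤ 0 := by
      by_contra h
      push Not at h
      have : 0 < 4 * l * (v.im * v.im) := mul_pos (by linarith) h
      linarith
    exact mul_self_eq_zero.1 (le_antisymm h5 (mul_self_nonneg _))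
  have hF : ∀ r : ℝ, c.re < r → H (r - c) + c = ((H (r - c) + c).re : ℂ) := by
    intro r hr
    exact Complex.ext rfl (by simpa using him r hr)
  have hanti : ∀ r₁ r₂ : ℝ, c.re < r₁ → r₁ < r₂ →
      (H (r₂ - c) + c).re * r₁ ≤ (H (r₁ - c) + c).re * r₂ := by
    intro r₁ r₂ h₁ h₁₂
    have h₂ := h₁.trans h₁₂
    have hr₁ : 0 < r₁ := hc.trans_lt h₁
    have hr₂ : 0 < r₂ := hc.trans_lt h₂
    have key := schwarzPick_of_commute_dilation hd hm hl hc hcomm (hmem _ h₂) (hmem _ h₁)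
    rw [show H (r₂ - c) - H (r₁ - c) = (H (r₂ - c) + c) - (H (r₁ - c) + c) by ring, hF r₁ h₁,
      hF r₂ h₂] at key
    have p₁ := hpos r₁ h₁
    have p₂ := hpos r₂ h₂
    generalize (H (r₁ - c) + c).re = v₁ at *
    generalize (H (r₂ - c) + c).re = v₂ at *
    rw [sub_add_cancel, sub_add_cancel, sub_sub_sub_cancel_right] at key
    simp only [Complex.conj_ofReal, ← Complex.ofReal_add, ← Complex.ofReal_sub, Complex.norm_real]
      at key
    rw [Real.norm_of_nonneg (add_pos hr₂ hr₁).le, Real.norm_of_nonneg (add_pos p₂ p₁).le,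
      Real.norm_of_nonneg (sub_pos.2 h₁₂).le] at key
    have h3 : (v₂ - v₁) * (r₂ + r₁) ≤ ‖v₂ - v₁‖ * (r₂ + r₁) :=
      mul_le_mul_of_nonneg_right (le_abs_self _) (add_pos hr₂ hr₁).le
    nlinarith
  have hconst : ∀ r₁ r₂ : ℝ, c.re < r₁ → r₁ < r₂ →
      (H (r₂ - c) + c).re * r₁ = (H (r₁ - c) + c).re * r₂ := by
    intro r₁ r₂ h₁ h₁₂
    refine le_antisymm (hanti r₁ r₂ h₁ h₁₂) ?_
    have hr₁ : 0 < r₁ := hc.trans_lt h₁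
    obtain ⟨n, hn⟩ := pow_unbounded_of_one_lt (r₂ / r₁) hl
    have h := hanti r₂ (l ^ n * r₁) (h₁.trans h₁₂) ((div_lt_iff₀ hr₁).1 hn)
    rw [hpow r₁ n h₁, Complex.re_ofReal_mul] at h
    refine le_of_mul_le_mul_left ?_ (pow_pos (by linarith : 0 < l) n)
    linarith
  have hr : c.re < c.re + 1 := by linarith
  have hr0 : 0 < c.re + 1 := by linarith
  refine ⟨(H ((c.re + 1 : ℝ) - c) + c).re / (c.re + 1), div_pos (hpos _ hr) hr0, ?_⟩
  refine eqOn_of_eqOn_segment (g := fun w => _ * (w + c) - c) isOpen_rightHalfPlane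
    convex_rightHalfPlane.isPreconnected hd (by fun_prop) (hmem _ hr) (b := 1) one_ne_zero ?_
  intro τ hτ _
  have h := hconst (c.re + 1) (c.re + 1 + τ) hr (by linarith)
  have h' := hF (c.re + 1 + τ) (by linarith)
  rw [show (((c.re + 1 : ℝ) : ℂ) - c) + τ * 1 = ((c.re + 1 + τ : ℝ) : ℂ) - c by push_cast; ring,
    eq_sub_iff_add_eq, sub_add_cancel, h', ← Complex.ofReal_mul, Complex.ofReal_inj,
    div_mul_eq_mul_div, eq_div_iff hr0.ne', h]

end Dilation

section Translation

variable {H : ℂ → ℂ} {b : ℂ}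

theorem commute_translation_pow (hb : 0 ≤ b.re)
    (hcomm : ∀ w ∈ rightHalfPlane, H (w + b) = H w + b) (n : ℕ) {w : ℂ}
    (hw : w ∈ rightHalfPlane) :
    w + n * b ∈ rightHalfPlane ∧ H (w + n * b) = H w + n * b := by
  induction n with
  | zero => simpa using hw
  | succ n ih =>
    have h := hcomm _ ih.1
    rw [ih.2] at h
    have e : ∀ z : ℂ, z + (n + 1 : ℕ) * b = z + n * b + b := fun z => by push_cast; ring
    rw [e, e]
    refine ⟨?_, h⟩
    have := ih.1
    simp only [rightHalfPlane, mem_ofPred_eq, Complex.add_re] at this ⊢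
    linarith

/-- A self-map commuting with a translation into the half-plane is a translation: far out along the
orbits the hyperbolic metric is proportional to the Euclidean one, so that the map is a Euclidean
contraction, and it moves the points of the segment from `w` to `w + b` in parallel. -/
theorem eq_translation_of_commute (hd : DifferentiableOn ℂ H rightHalfPlane)
    (hm : MapsTo H rightHalfPlane rightHalfPlane) (hb : 0 < b.re)
    (hcomm : ∀ w ∈ rightHalfPlane, H (w + b) = H w + b) :
    ∃ β : ℂ, ∀ w ∈ rightHalfPlane, H w = w + β := by
  have hb0 : b ≠ 0 := fun h => by simp [h] at hb
  have hlip : ∀ w₁ ∈ rightHalfPlane, ∀ w₂ ∈ rightHalfPlane, ‖H w₁ - H w₂‖ ≤ ‖w₁ - w₂‖ := by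
    intro w₁ h₁ w₂ h₂
    have hlim : ∀ x y : ℂ, Tendsto (fun n : ℕ => ‖x‖ * ‖y * ((n : ℂ)⁻¹) + (b + conj b)‖) atTop
        (𝓝 (‖x‖ * ‖b + conj b‖)) := by
      intro x y
      have : Tendsto (fun n : ℕ => ((n : ℂ)⁻¹)) atTop (𝓝 0) := tendsto_inv_atTop_nhds_zero_nat
      simpa using ((this.const_mul y).add_const (b + conj b)).norm.const_mul ‖x‖
    have h3 : ‖H w₁ - H w₂‖ * ‖b + conj b‖ ≤ ‖w₁ - w₂‖ * ‖b + conj b‖ := by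
      refine le_of_tendsto_of_tendsto (hlim _ (w₁ + conj w₂)) (hlim _ (H w₁ + conj (H w₂))) ?_
      filter_upwards [eventually_gt_atTop 0] with n hn
      obtain ⟨m₁, e₁⟩ := commute_translation_pow hb.le hcomm n h₁
      obtain ⟨m₂, e₂⟩ := commute_translation_pow hb.le hcomm n h₂
      have key := schwarzPick_rightHalfPlane hd hm m₁ m₂
      rw [e₁, e₂, add_sub_add_right_eq_sub, add_sub_add_right_eq_sub] at key
      have hn' : (n : ℂ) ≠ 0 := Nat.cast_ne_zero.2 hn.ne'
      have e : ∀ x y : ℂ, ‖x + n * b + conj (y + n * b)‖ =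
          n * ‖(x + conj y) * (n : ℂ)⁻¹ + (b + conj b)‖ := by
        intro x y
        have hnn : (n : ℝ) = ‖(n : ℂ)‖ := by simp
        rw [hnn, ← norm_mul]
        congr 1
        simp only [map_add, map_mul, Complex.conj_natCast]
        field_simp
        ring
      rw [e, e] at key
      refine le_of_mul_le_mul_left ?_ (Nat.cast_pos (α := ℝ).2 hn)
      linarith
    refine le_of_mul_le_mul_right h3 (norm_pos_iff.2 fun h => ?_)
    have := congrArg Complex.re h
    simp at this
    linarith
  have h1 := one_mem_rightHalfPlane
  refine ⟨H 1 - 1, ?_⟩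
  refine eqOn_of_eqOn_segment (g := fun w => w + (H 1 - 1)) isOpen_rightHalfPlane
    convex_rightHalfPlane.isPreconnected hd (by fun_prop) h1 hb0 ?_
  intro τ hτ hτ1
  have hmem : ∀ τ : ℝ, 0 ≤ τ → 1 + τ * b ∈ rightHalfPlane := by
    intro τ hτ
    simp [rightHalfPlane]
    nlinarith
  have a1 := hlip _ (hmem τ hτ.le) 1 h1
  have a2 := hlip (1 + b) (by simpa using hmem 1 zero_le_one) _ (hmem τ hτ.le)
  rw [hcomm 1 h1] at a2
  have hbn : 0 < ‖b‖ := norm_pos_iff.2 hb0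
  obtain ⟨u, hu⟩ : ∃ u, H (1 + τ * b) - H 1 = u * b := ⟨_, (div_mul_cancel₀ _ hb0).symm⟩
  rw [hu, add_sub_cancel_left, norm_mul, norm_mul, Complex.norm_real,
    Real.norm_of_nonneg hτ.le] at a1
  have a1' : ‖u‖ ≤ τ := le_of_mul_le_mul_right a1 hbn
  rw [show H 1 + b - H (1 + τ * b) = (1 - u) * b by linear_combination -hu,
    show 1 + b - (1 + τ * b) = ((1 - τ : ℝ) : ℂ) * b by push_cast; ring, norm_mul, norm_mul,
    Complex.norm_real, Real.norm_of_nonneg (by linarith)] at a2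
  have a2' : ‖1 - u‖ ≤ 1 - τ := le_of_mul_le_mul_right a2 hbn
  have hre : u.re = τ := by
    have r1 := (Complex.re_le_norm u).trans a1'
    have r2 := (Complex.re_le_norm (1 - u)).trans a2'
    simp at r2
    linarith
  have huτ : u = τ := by
    refine Complex.ext hre ?_
    have := pow_le_pow_left₀ (norm_nonneg _) a1' 2
    rw [← Complex.normSq_eq_norm_sq, Complex.normSq_apply, hre] at this
    have h0 : u.im * u.im ≤ 0 := by nlinarith
    simpa using mul_self_eq_zero.1 (le_antisymm h0 (mul_self_nonneg _))
  rw [huτ] at hu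
  linear_combination hu

theorem re_le_re_of_commute_translation (hd : DifferentiableOn ℂ H rightHalfPlane)
    (hm : MapsTo H rightHalfPlane rightHalfPlane) (hb : b.re = 0) (hb0 : b ≠ 0)
    (hcomm : ∀ w ∈ rightHalfPlane, H (w + b) = H w + b) {w : ℂ} (hw : w ∈ rightHalfPlane) :
    w.re ≤ (H w).re := by
  have hwb : w + b ∈ rightHalfPlane := by simpa [rightHalfPlane, hb] using hw
  have key := schwarzPick_rightHalfPlane hd hm hwb hw
  rw [hcomm w hw, add_sub_cancel_left, add_sub_cancel_left] at key
  have h2 := pow_le_pow_left₀ (norm_nonneg _)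
    (le_of_mul_le_mul_left key (norm_pos_iff.2 hb0)) 2
  rw [← Complex.normSq_eq_norm_sq, ← Complex.normSq_eq_norm_sq, Complex.normSq_apply,
    Complex.normSq_apply] at h2
  simp [hb] at h2
  have hH := hm hw
  simp only [rightHalfPlane, mem_ofPred_eq] at hw hH
  nlinarith

end Translation

/-! ### Semigroups on the half-plane with a prescribed affine member -/

theorem eq_smul_of_additive {E : Type*} [NormedAddCommGroup E] [NormedSpace ℝ E] {f : ℝ≥0 → E}
    (hf : Continuous f) (hadd : ∀ s t, f (s + t) = f s + f t) {s : ℝ≥0} (hs : 0 < s) (t : ℝ≥0) :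
    f t = ((t : ℝ) / s) • f s := by
  have h0 : f 0 = 0 := by simpa using hadd 0 0
  have key : ∀ x y : ℝ, f (x + y).toNNReal - f (-(x + y)).toNNReal =
      (f x.toNNReal - f (-x).toNNReal) + (f y.toNNReal - f (-y).toNNReal) := by
    intro x y
    have e : (x + y).toNNReal + (-x).toNNReal + (-y).toNNReal =
        (-(x + y)).toNNReal + x.toNNReal + y.toNNReal := by
      apply NNReal.eq
      have hx := max_zero_sub_eq_self x
      have hy := max_zero_sub_eq_self y
      have hxy := max_zero_sub_eq_self (x + y)
      simp only [NNReal.coe_add, Real.coe_toNNReal']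
      linarith
    have := congrArg f e
    simp only [hadd] at this
    rw [sub_add_sub_comm, sub_eq_sub_iff_add_eq_add, add_comm (f (-x).toNNReal), ← add_assoc,
      add_right_comm, this]
    abel
  let F : ℝ →+ E := ⟨⟨fun x : ℝ => f x.toNNReal - f (-x).toNNReal, by simp⟩, key⟩
  have hF : Continuous F := by
    change Continuous fun x : ℝ => f x.toNNReal - f (-x).toNNReal
    exact (hf.comp continuous_real_toNNReal).sub
      (hf.comp (continuous_real_toNNReal.comp continuous_neg))
  have hFf : ∀ t : ℝ≥0, F t = f t := by
    intro t
    change f (t : ℝ).toNNReal - f (-(t : ℝ)).toNNReal = f t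
    simp [Real.toNNReal_of_nonpos, h0]
  have hs' : (s : ℝ) ≠ 0 := by exact_mod_cast hs.ne'
  rw [← hFf, ← hFf, ← map_real_smul F hF, smul_eq_mul, div_mul_cancel₀ _ hs']

/-- A one-parameter semigroup, indexed by `[0, ∞)`, of holomorphic self-maps of the right
half-plane, continuous in the parameter at each point. -/
structure IsHalfPlaneSemigroup (H : ℝ≥0 → ℂ → ℂ) : Prop where
  differentiableOn : ∀ t, DifferentiableOn ℂ (H t) rightHalfPlane
  mapsTo : ∀ t, MapsTo (H t) rightHalfPlane rightHalfPlane
  add : ∀ s t, EqOn (H s ∘ H t) (H (s + t)) rightHalfPlane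
  continuous : ∀ w ∈ rightHalfPlane, Continuous fun t => H t w

namespace IsHalfPlaneSemigroup

variable {H : ℝ≥0 → ℂ → ℂ} {s : ℝ≥0}

theorem commute (h : IsHalfPlaneSemigroup H) (s t : ℝ≥0) {w : ℂ} (hw : w ∈ rightHalfPlane) :
    H s (H t w) = H t (H s w) := by
  have h1 := h.add s t hw
  have h2 := h.add t s hw
  rw [add_comm t s] at h2
  exact h1.trans h2.symm

theorem eq_of_dilation (h : IsHalfPlaneSemigroup H) (hs : 0 < s) {l : ℝ} {c : ℂ} (hl : 1 < l)
    (hc : 0 ≤ c.re) (hHs : ∀ w ∈ rightHalfPlane, H s w = l * (w + c) - c) (t : ℝ≥0) {w : ℂ}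
    (hw : w ∈ rightHalfPlane) :
    H t w = Real.exp (t / s * Real.log l) * (w + c) - c := by
  have hex : ∀ t, ∃ L : ℝ, 0 < L ∧ ∀ w ∈ rightHalfPlane, H t w = L * (w + c) - c := by
    intro t
    refine eq_dilation_of_commute (h.differentiableOn t) (h.mapsTo t) hl hc fun w hw => ?_
    rw [← hHs w hw, ← h.commute s t hw, hHs _ (h.mapsTo t hw)]
  choose L hLpos hL using hex
  have h1 := one_mem_rightHalfPlane
  have h1c : (1 : ℂ) + c ≠ 0 := fun h => by
    have := congrArg Complex.re h
    simp at this
    linarith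
  have hLeq : ∀ t, (L t : ℂ) = (H t 1 + c) / (1 + c) := by
    intro t
    rw [hL t 1 h1, sub_add_cancel, mul_div_cancel_right₀ _ h1c]
  have hcont : Continuous L := by
    have : Continuous fun t => (L t : ℂ) := by
      simp only [hLeq]
      exact ((h.continuous 1 h1).add_const c).div_const _
    exact Complex.continuous_re.comp this
  have hmul : ∀ s t, L (s + t) = L s * L t := by
    intro s t
    have e := h.add s t h1
    rw [Function.comp_apply, hL s _ (h.mapsTo t h1), hL t 1 h1, hL (s + t) 1 h1] at e
    have : (L (s + t) : ℂ) * (1 + c) = (L s * L t : ℂ) * (1 + c) := by linear_combination -e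
    exact_mod_cast mul_right_cancel₀ h1c this
  have hLs : L s = l := by
    have e := hLeq s
    rw [hHs 1 h1, sub_add_cancel, mul_div_cancel_right₀ _ h1c] at e
    exact_mod_cast e
  have hlog := eq_smul_of_additive (f := fun t => Real.log (L t))
    (hcont.log fun t => (hLpos t).ne')
    (fun s t => by rw [hmul, Real.log_mul (hLpos s).ne' (hLpos t).ne']) hs t
  simp only [hLs, smul_eq_mul] at hlog
  rw [hL t w hw, ← hlog, Real.exp_log (hLpos t)]

/-- When `b` is purely imaginary the translation has a large commutant, and the rest of the
semigroup is needed: no `H t` decreases the real part, and a composition of `H t` with another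
member of the semigroup preserves it. -/
theorem eq_translation (h : IsHalfPlaneSemigroup H) (hs : 0 < s) {b : ℂ} (hb : 0 ≤ b.re)
    (hb0 : b ≠ 0) (hHs : ∀ w ∈ rightHalfPlane, H s w = w + b) (t : ℝ≥0) :
    ∃ β : ℂ, ∀ w ∈ rightHalfPlane, H t w = w + β := by
  have hcomm : ∀ t, ∀ w ∈ rightHalfPlane, H t (w + b) = H t w + b := by
    intro t w hw
    rw [← hHs w hw, ← h.commute s t hw, hHs _ (h.mapsTo t hw)]
  rcases hb.lt_or_eq with hb' | hb'
  · exact eq_translation_of_commute (h.differentiableOn t) (h.mapsTo t) hb' (hcomm t)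
  have hle : ∀ t, ∀ w ∈ rightHalfPlane, w.re ≤ (H t w).re := fun t w hw =>
    re_le_re_of_commute_translation (h.differentiableOn t) (h.mapsTo t) hb'.symm hb0 (hcomm t) hw
  have hns : ∀ n : ℕ, ∀ w ∈ rightHalfPlane, (H ((n + 1) * s) w).re = w.re := by
    intro n
    induction n with
    | zero => intro w hw; simp [hHs w hw, ← hb']
    | succ n ih =>
      intro w hw
      have e := h.add s ((n + 1) * s) hw
      rw [show s + (n + 1) * s = ((n + 1 : ℕ) + 1) * s by push_cast; ring] at e
      rw [← e, Function.comp_apply, hHs _ (h.mapsTo _ hw), Complex.add_re, ih w hw, ← hb', add_zero]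
  have hre : ∀ w ∈ rightHalfPlane, (H t w).re = w.re := by
    intro w hw
    refine le_antisymm ?_ (hle t w hw)
    obtain ⟨n, hn⟩ := exists_nat_ge (t / s)
    have htn : t ≤ (n + 1) * s := by
      rw [div_le_iff₀ hs] at hn
      exact hn.trans (by gcongr; simp)
    have e := h.add ((n + 1) * s - t) t hw
    rw [tsub_add_cancel_of_le htn] at e
    rw [← hns n w hw, ← e]
    exact hle _ _ (h.mapsTo t hw)
  have hA : AnalyticOnNhd ℂ (fun w => H t w - w) rightHalfPlane :=
    ((h.differentiableOn t).sub differentiableOn_id).analyticOnNhd isOpen_rightHalfPlane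
  obtain ⟨β, hβ⟩ := hA.eq_const_of_re_eq_const (c₀ := 0) (fun w hw => by simp [hre w hw])
    isOpen_rightHalfPlane (convex_rightHalfPlane.isConnected ⟨1, one_mem_rightHalfPlane⟩)
  exact ⟨β, fun w hw => by rw [← hβ w hw]; ring⟩

theorem eq_of_translation (h : IsHalfPlaneSemigroup H) (hs : 0 < s) {b : ℂ} (hb : 0 ≤ b.re)
    (hb0 : b ≠ 0) (hHs : ∀ w ∈ rightHalfPlane, H s w = w + b) (t : ℝ≥0) {w : ℂ}
    (hw : w ∈ rightHalfPlane) : H t w = w + ((t : ℝ) / s : ℝ) * b := by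
  choose β hβ using h.eq_translation hs hb hb0 hHs
  have h1 := one_mem_rightHalfPlane
  have hβeq : ∀ t, β t = H t 1 - 1 := fun t => by rw [hβ t 1 h1]; ring
  have hβs : β s = b := by rw [hβeq, hHs 1 h1]; ring
  have hlin := eq_smul_of_additive (f := β)
    (by rw [show β = _ from funext hβeq]; exact (h.continuous 1 h1).sub continuous_const)
    (fun s t => by
      have e := h.add s t h1
      rw [Function.comp_apply, hβ s _ (h.mapsTo t h1), hβ t 1 h1, hβ (s + t) 1 h1] at e
      linear_combination -e) hs t
  rw [hβ t w hw, hlin, hβs, Complex.real_smul]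

end IsHalfPlaneSemigroup

theorem isSemiflow_dilation {κ : ℝ} {c : ℂ} (hκ : 0 ≤ κ) (hc : 0 ≤ c.re) :
    IsSemiflow rightHalfPlane (fun t w => Real.exp (t * κ) * (w + c) - c) where
  differentiableOn t := by fun_prop
  mapsTo t w hw :=
    dilation_mem_rightHalfPlane (Real.one_le_exp (mul_nonneg t.coe_nonneg hκ)) hc hw
  zero w _ := by simp
  add s t w _ := by
    simp only [Function.comp_apply, sub_add_cancel, NNReal.coe_add, add_mul, Real.exp_add,
      Complex.ofReal_mul, mul_assoc]
  continuousOn := by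
    refine Continuous.continuousOn ?_
    simp only [Function.uncurry_def]
    fun_prop

theorem isSemiflow_translation {b : ℂ} (hb : 0 ≤ b.re) :
    IsSemiflow rightHalfPlane (fun t w => w + (t : ℝ) * b) where
  differentiableOn t := by fun_prop
  mapsTo t w hw := by
    simp only [rightHalfPlane, mem_ofPred_eq] at *
    simp
    nlinarith [mul_nonneg t.coe_nonneg hb]
  zero w _ := by simp
  add s t w _ := by
    simp only [Function.comp_apply, NNReal.coe_add, Complex.ofReal_add]
    ring
  continuousOn := by
    refine Continuous.continuousOn ?_
    simp only [Function.uncurry_def]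
    fun_prop

/-- An affine self-map of the half-plane, other than the identity, is a member of exactly one
semigroup, once its parameter `s` is prescribed. -/
theorem exists_unique_semiflow_affine {l : ℝ} {b : ℂ} {s : ℝ≥0} (hl : 1 ≤ l) (hb : 0 ≤ b.re)
    (hne : l = 1 → b ≠ 0) (hs : 0 < s) :
    ∃ G, IsSemiflow rightHalfPlane G ∧ (∀ w ∈ rightHalfPlane, G s w = l * w + b) ∧
      ∀ H, IsHalfPlaneSemigroup H → (∀ w ∈ rightHalfPlane, H s w = l * w + b) →
        ∀ t, EqOn (H t) (G t) rightHalfPlane := by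
  have hs' : (s : ℝ) ≠ 0 := by exact_mod_cast hs.ne'
  rcases hl.eq_or_lt with rfl | hl
  · have hb' : 0 ≤ (((s : ℝ)⁻¹ : ℝ) * b).re := by
      rw [Complex.re_ofReal_mul]
      exact mul_nonneg (inv_nonneg.2 s.coe_nonneg) hb
    refine ⟨_, isSemiflow_translation hb', fun w _ => ?_, fun H hH hHs t w hw => ?_⟩
    · rw [← mul_assoc, ← Complex.ofReal_mul, mul_inv_cancel₀ hs']
      simp
    · rw [hH.eq_of_translation hs hb (hne rfl) (fun w hw => by simpa using hHs w hw) t hw,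
        ← mul_assoc, ← Complex.ofReal_mul, div_eq_mul_inv]
  · have hl1 : (l : ℂ) - 1 ≠ 0 := by
      rw [← Complex.ofReal_one, ← Complex.ofReal_sub]
      exact Complex.ofReal_ne_zero.2 (by linarith)
    -- the affine map is the dilation by `l` with centre `-b / (l - 1)`
    have hc : 0 ≤ (b / (l - 1)).re := by
      rw [← Complex.ofReal_one, ← Complex.ofReal_sub, Complex.div_ofReal_re]
      exact div_nonneg hb (by linarith)
    have hT : ∀ w : ℂ, l * (w + b / (l - 1)) - b / (l - 1) = l * w + b := fun w => by
      field_simp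
      ring
    refine ⟨_, isSemiflow_dilation (div_nonneg (Real.log_nonneg hl.le) s.coe_nonneg) hc,
      fun w _ => ?_, fun H hH hHs t w hw => ?_⟩
    · rw [mul_div_cancel₀ _ hs', Real.exp_log (by linarith), hT]
    · rw [hH.eq_of_dilation hs hl hc (fun w hw => by rw [hT, hHs w hw]) t hw, div_mul_eq_mul_div,
        mul_div_assoc]

/-! ### Parabolic and hyperbolic linear fractional maps -/

/-- The conformal map of the disk onto the right half-plane that sends the boundary point `p`
to infinity. -/
theorem isConformalEquiv_boundaryCayley {p : ℂ} (hp : ‖p‖ = 1) :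
    ∃ τ, IsConformalEquiv disk rightHalfPlane (fun z => (p + z) / (p - z)) τ := by
  have hp0 : p ≠ 0 := norm_ne_zero_iff.1 (by simp [hp])
  have h := (isConformalEquiv_mul (ω := p⁻¹) (by simp [hp])).trans
    (isConformalEquiv_cayley one_mem_rightHalfPlane).symm
  have e : (cayleyInv 1 ∘ fun z => p⁻¹ * z) = fun z => (p + z) / (p - z) := by
    funext z
    rw [Function.comp_apply, cayleyInv, map_one, one_mul, inv_mul_eq_div, one_add_div hp0,
      one_sub_div hp0, div_div_div_cancel_right₀ hp0]
  rw [e] at h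
  exact ⟨_, h⟩

theorem tendsto_radius_nhdsWithin_approachRegion {p : ℂ} (hp : ‖p‖ = 1) :
    Tendsto (fun r : ℝ => (r : ℂ) * p) (𝓝[<] 1) (𝓝[approachRegion p 1] p) := by
  refine tendsto_nhdsWithin_iff.2 ⟨?_, ?_⟩
  · have : Continuous fun r : ℝ => (r : ℂ) * p := by fun_prop
    simpa using (this.tendsto 1).mono_left nhdsWithin_le_nhds
  · filter_upwards [Ioo_mem_nhdsLT (zero_lt_one' ℝ)] with r hr
    have h1 : ‖(r : ℂ) * p‖ = r := by
      rw [norm_mul, hp, mul_one, Complex.norm_real, Real.norm_of_nonneg hr.1.le]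
    have h2 : ‖(r : ℂ) * p - p‖ = 1 - r := by
      rw [show (r : ℂ) * p - p = ((r - 1 : ℝ) : ℂ) * p by push_cast; ring, norm_mul, hp, mul_one,
        Complex.norm_real, Real.norm_of_nonpos (by linarith [hr.2]), neg_sub]
    refine ⟨mem_disk.2 (by rw [h1]; exact hr.2), ?_⟩
    rw [h1, h2, one_mul]

/-- With its Denjoy–Wolff point `p` moved to infinity, a linear fractional self-map of the disk with
angular derivative `α` at `p` becomes the affine map `w ↦ w / α + b`. -/
theorem exists_affine_model {φ : ℂ → ℂ} (hφ : IsSelfMap φ) (hL : IsLFT φ) {p : ℂ} {α : ℝ}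
    (hm : HasBoundaryMultiplier φ p α) (hα : α ≤ 1) :
    ∃ (l : ℝ) (b : ℂ), 1 ≤ l ∧ 0 ≤ b.re ∧ (l = 1 → b ≠ 0) ∧
      ∀ z ∈ disk, (p + φ z) / (p - φ z) = l * ((p + z) / (p - z)) + b := by
  obtain ⟨⟨hp, hDW⟩, hang⟩ := hm
  obtain ⟨a, b, c, d, hdet, hf⟩ := hL
  obtain ⟨τ, hσ⟩ := isConformalEquiv_boundaryCayley hp
  have hne : ∀ z ∈ disk, p - z ≠ 0 := by
    intro z hz h
    rw [mem_disk, ← sub_eq_zero.1 h, hp] at hz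
    exact lt_irrefl _ hz
  have hrad := tendsto_radius_nhdsWithin_approachRegion hp
  have hq := (hang 1).comp hrad
  have hrp : Tendsto (fun r : ℝ => (r : ℂ) * p) (𝓝[<] 1) (𝓝 p) :=
    hrad.mono_right nhdsWithin_le_nhds
  have hin : ∀ᶠ r : ℝ in 𝓝[<] 1, (r : ℂ) * p ∈ disk := by
    filter_upwards [hrad.eventually self_mem_nhdsWithin] with r hr using hr.1
  have hfix : a * p + b = p * (c * p + d) := by
    have h1 : Tendsto (fun r : ℝ => (α : ℂ) * 0 + p) (𝓝[<] (1 : ℝ)) (𝓝 p) := by simp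
    have h2 : Tendsto (fun r : ℝ => φ (r * p)) (𝓝[<] 1) (𝓝 p) := by
      have := (hq.mul (hrp.sub_const p)).add_const p
      rw [sub_self, mul_zero, zero_add] at this
      refine this.congr' ?_
      filter_upwards [hin] with r hr
      have := hne _ hr
      simp only [Function.comp_apply]
      rw [div_mul_cancel₀ _ (by rw [← neg_sub]; exact neg_ne_zero.2 this), sub_add_cancel]
    refine tendsto_nhds_unique ((hrp.const_mul a).add_const b)
      ((h2.mul ((hrp.const_mul c).add_const d)).congr' ?_)
    filter_upwards [hin] with r hr
    obtain ⟨h3, h4⟩ := hf _ hr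
    rw [h4, div_mul_cancel₀ _ h3]
  have hcp : c * p + d ≠ 0 := by
    intro h
    rw [h, mul_zero] at hfix
    exact hdet (by linear_combination a * h - c * hfix)
  have he0 : a - p * c ≠ 0 := by
    intro h
    exact hdet (by linear_combination (c * p + d) * h - c * hfix)
  have hdiff : ∀ z ∈ disk, φ z - p = (a - p * c) * (z - p) / (c * z + d) := by
    intro z hz
    obtain ⟨h3, h4⟩ := hf z hz
    rw [h4, div_sub' h3, div_left_inj' h3]
    linear_combination hfix
  have hmult : α * (c * p + d) = a - p * c := by
    refine tendsto_nhds_unique (hq.mul ((hrp.const_mul c).add_const d))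
      (tendsto_const_nhds.congr' ?_)
    filter_upwards [hin] with r hr
    obtain ⟨h3, h4⟩ := hf _ hr
    have h5 : (r : ℂ) * p - p ≠ 0 := by
      rw [← neg_sub]
      exact neg_ne_zero.2 (hne _ hr)
    simp only [Function.comp_apply]
    rw [hdiff _ hr, div_mul_eq_mul_div, div_mul_cancel₀ _ h3, mul_div_cancel_right₀ _ h5]
  have hα0 : α ≠ 0 := by
    rintro rfl
    rw [Complex.ofReal_zero, zero_mul] at hmult
    exact he0 hmult.symm
  have hα0' : (α : ℂ) ≠ 0 := Complex.ofReal_ne_zero.2 hα0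
  have hmodel : ∀ z ∈ disk, (p + φ z) / (p - φ z) =
      (α⁻¹ : ℝ) * ((p + z) / (p - z)) + ((α⁻¹ : ℝ) - 1 - 2 * p * c / (a - p * c)) := by
    intro z hz
    have h1 := hne z hz
    have h2 := hne _ (hφ.mapsTo hz)
    obtain ⟨h3, h4⟩ := hf z hz
    have h5 : (p - φ z) * (c * z + d) = (a - p * c) * (p - z) := by
      rw [← neg_sub (φ z) p, hdiff z hz, neg_mul, div_mul_cancel₀ _ h3]
      ring
    have h6 : (p + φ z) / (p - φ z) = 2 * p * (c * z + d) / ((a - p * c) * (p - z)) - 1 := by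
      rw [← h5, mul_div_mul_right _ _ h3, div_sub_one h2]
      congr 1
      ring
    rw [h6, Complex.ofReal_inv]
    field_simp
    linear_combination 2 * p * hmult
  generalize ((α⁻¹ : ℝ) : ℂ) - 1 - 2 * p * c / (a - p * c) = B at hmodel
  have hpos : ∀ x : ℝ, 0 < x → 0 < α⁻¹ * x + B.re := by
    intro x hx
    have hx' : (x : ℂ) ∈ rightHalfPlane := by simpa [rightHalfPlane] using hx
    have h1 := hσ.mapsTo (hφ.mapsTo (hσ.mapsTo_inv hx'))
    have h2 := hmodel _ (hσ.mapsTo_inv hx')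
    have h3 := hσ.rightInvOn hx'
    rw [h3] at h2
    simp only [rightHalfPlane, mem_ofPred_eq, h2] at h1
    rwa [Complex.add_re, Complex.re_ofReal_mul, Complex.ofReal_re] at h1
  have hαpos : 0 < α := by
    refine lt_of_le_of_ne (le_of_not_gt fun hneg => ?_) hα0.symm
    have h1 := hpos (-α * (|B.re| + 1)) (mul_pos (by linarith) (by positivity))
    rw [← mul_assoc, mul_neg, inv_mul_cancel₀ hα0] at h1
    linarith [le_abs_self B.re]
  refine ⟨α⁻¹, B, (one_le_inv₀ hαpos).2 hα, ?_, ?_, hmodel⟩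
  · by_contra hB
    push Not at hB
    have h1 := hpos (α * (-B.re / 2)) (mul_pos hαpos (by linarith))
    rw [← mul_assoc, inv_mul_cancel₀ hα0] at h1
    linarith
  · -- otherwise `φ` fixes `0`, and its iterates there do not converge to `p`
    rintro h1 rfl
    have h0 := hmodel 0 zero_mem_disk
    rw [h1, Complex.ofReal_one, one_mul, add_zero] at h0
    have hfix0 : φ 0 = 0 := hσ.bijOn.injOn (hφ.mapsTo zero_mem_disk) zero_mem_disk h0
    have hlim := (hDW {0} (by simpa using zero_mem_disk) isCompact_singleton).tendsto_at
      (mem_singleton 0)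
    have hit : ∀ n : ℕ, φ^[n] 0 = 0 := fun n => Function.iterate_fixed hfix0 n
    simp only [hit] at hlim
    have := tendsto_nhds_unique hlim tendsto_const_nhds
    simp [this] at hp

theorem IsSemigroup.isHalfPlaneSemigroup {h : ℝ≥0 → ℂ → ℂ} (hh : IsSemigroup h) {σ τ : ℂ → ℂ}
    (hσ : IsConformalEquiv disk rightHalfPlane σ τ) :
    IsHalfPlaneSemigroup (fun t => σ ∘ h t ∘ τ) where
  differentiableOn t := hσ.differentiableOn.comp ((hh.isSelfMap t).differentiableOn.comp
    hσ.differentiableOn_inv hσ.mapsTo_inv) ((hh.isSelfMap t).mapsTo.comp hσ.mapsTo_inv)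
  mapsTo t := hσ.mapsTo.comp ((hh.isSelfMap t).mapsTo.comp hσ.mapsTo_inv)
  add s t w hw := by
    have h1 := (hh.isSelfMap t).mapsTo (hσ.mapsTo_inv hw)
    have h2 := hh.add s t (hσ.mapsTo_inv hw)
    simp only [Function.comp_apply] at h2 ⊢
    rw [hσ.leftInvOn h1, h2]
  continuous w hw := by
    have hz := hσ.mapsTo_inv hw
    refine continuous_iff_continuousAt.2 fun t => ?_
    have h1 : ContinuousAt (fun t => h t (τ w)) t :=
      (hh.strongly_continuous t {τ w} (by simpa using hz) isCompact_singleton).tendsto_at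
        (mem_singleton _)
    have h2 : ContinuousAt σ (h t (τ w)) := (hσ.differentiableOn.differentiableAt
      (isOpen_disk.mem_nhds ((hh.isSelfMap t).mapsTo hz))).continuousAt
    exact ContinuousAt.comp (f := fun t => h t (τ w)) h2 h1

/-- A parabolic or hyperbolic linear fractional map lies in exactly one semigroup, up to the choice
of the parameter `s`. -/
theorem exists_unique_semigroup {φ : ℂ → ℂ} (hφ : IsSelfMap φ) (hL : IsLFT φ)
    (h : IsParabolic φ ∨ IsHyperbolic φ) {s : ℝ≥0} (hs : 0 < s) :
    ∃ g, IsSemigroup g ∧ EqOn (g s) φ disk ∧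
      ∀ h, IsSemigroup h → EqOn (h s) φ disk → ∀ t, EqOn (h t) (g t) disk := by
  obtain ⟨p, α, hm, hα⟩ : ∃ p α, HasBoundaryMultiplier φ p α ∧ α ≤ 1 := by
    rcases h with ⟨-, p, hm⟩ | ⟨-, p, α, hm, hα⟩
    exacts [⟨p, 1, hm, le_rfl⟩, ⟨p, α, hm, hα.le⟩]
  obtain ⟨l, b, hl, hb, hne, hmodel⟩ := exists_affine_model hφ hL hm hα
  obtain ⟨τ, hσ⟩ := isConformalEquiv_boundaryCayley hm.1.1
  obtain ⟨G, hG, hGs, huniq⟩ := exists_unique_semiflow_affine hl hb hne hs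
  refine ⟨_, hG.isSemigroup hσ, fun z hz => ?_, fun h hh hhs t z hz => ?_⟩
  · simp only [Function.comp_apply]
    rw [hGs _ (hσ.mapsTo hz), ← hmodel z hz]
    exact hσ.leftInvOn (hφ.mapsTo hz)
  · have e := huniq _ (hh.isHalfPlaneSemigroup hσ) (fun w hw => by
      have hz := hσ.mapsTo_inv hw
      have hw' := hσ.rightInvOn hw
      simp only [Function.comp_apply] at hw' ⊢
      rw [hhs hz, hmodel _ hz, hw']) t (hσ.mapsTo hz)
    have hz' := hσ.leftInvOn hz
    simp only [Function.comp_apply] at e hz' ⊢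
    rw [← e, hz']
    exact (hσ.leftInvOn ((hh.isSelfMap t).mapsTo hz)).symm

/-! ### Elliptic automorphisms -/

theorem isSemiflow_rotation (θ : ℝ) :
    IsSemiflow disk (fun t z => Complex.exp ((t * θ : ℝ) * Complex.I) * z) where
  differentiableOn t := by fun_prop
  mapsTo t z hz := by
    rw [mem_disk] at *
    rwa [norm_mul, Complex.norm_exp_ofReal_mul_I, one_mul]
  zero z _ := by simp
  add s t z _ := by
    simp only [Function.comp_apply, ← mul_assoc, ← Complex.exp_add]
    congr 2
    push_cast
    ring
  continuousOn := by
    refine Continuous.continuousOn ?_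
    simp only [Function.uncurry_def]
    fun_prop

/-- An automorphism of the disk that fixes `0` is a rotation: by the Schwarz lemma for it and for
its inverse it preserves the modulus. -/
theorem IsConformalEquiv.exists_rotation {σ τ : ℂ → ℂ} (h : IsConformalEquiv disk disk σ τ)
    (h0 : σ 0 = 0) : ∃ ω : ℂ, ‖ω‖ = 1 ∧ ∀ z ∈ disk, σ z = ω * z := by
  have hτ0 : τ 0 = 0 := by simpa [h0] using h.leftInvOn zero_mem_disk
  have schwarz : ∀ {f : ℂ → ℂ}, DifferentiableOn ℂ f disk → MapsTo f disk disk → f 0 = 0 →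
      ∀ z ∈ disk, ‖f z‖ ≤ ‖z‖ := fun hd hm h0 z hz =>
    Complex.norm_le_norm_of_mapsTo_ball hd (hm.mono_right Metric.ball_subset_closedBall) h0
      (mem_disk.1 hz)
  have hnorm : ∀ z ∈ disk, ‖σ z‖ = ‖z‖ := by
    intro z hz
    refine le_antisymm (schwarz h.differentiableOn h.mapsTo h0 z hz) ?_
    have := schwarz h.differentiableOn_inv h.mapsTo_inv hτ0 _ (h.mapsTo hz)
    rwa [h.leftInvOn hz] at this
  have hd : DifferentiableOn ℂ (dslope σ 0) disk :=
    (Complex.differentiableOn_dslope (isOpen_disk.mem_nhds zero_mem_disk)).2 h.differentiableOn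
  have hσd : ∀ z, σ z = dslope σ 0 z * z := by
    intro z
    have := sub_smul_dslope σ 0 z
    rw [h0, sub_zero, sub_zero, smul_eq_mul] at this
    rw [← this, mul_comm]
  have hone : ∀ z ∈ disk, z ≠ 0 → ‖dslope σ 0 z‖ = 1 := by
    intro z hz hz0
    have := hnorm z hz
    rw [hσd, norm_mul] at this
    exact mul_right_cancel₀ (norm_ne_zero_iff.2 hz0) (by rw [this, one_mul])
  have hhalf : (1 / 2 : ℂ) ∈ disk := by rw [mem_disk]; norm_num
  have hle : ∀ z ∈ disk, ‖dslope σ 0 z‖ ≤ 1 := by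
    intro z hz
    have := Complex.norm_dslope_le_div_of_mapsTo_ball (R₁ := 1) (R₂ := 1) (c := 0)
      h.differentiableOn (by rw [h0]; exact h.mapsTo.mono_right Metric.ball_subset_closedBall) hz
    simpa using this
  have hmax : IsMaxOn (norm ∘ dslope σ 0) disk (1 / 2 : ℂ) := by
    intro z hz
    simp only [Function.comp_apply, mem_ofPred_eq]
    rw [hone _ hhalf (by norm_num)]
    exact hle z hz
  have hconst := Complex.eqOn_of_isPreconnected_of_isMaxOn_norm isConnected_disk.isPreconnected
    isOpen_disk hd hhalf hmax
  refine ⟨_, hone _ hhalf (by norm_num), fun z hz => ?_⟩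
  rw [hσd z, hconst hz]
  rfl

theorem belongsToSemigroup_of_isDiskAut {φ : ℂ → ℂ} (hφ : IsDiskAut φ) {p : ℂ} (hp : p ∈ disk)
    (hfix : φ p = p) : BelongsToSemigroup φ := by
  obtain ⟨τ, hτ⟩ := hφ.exists_isConformalEquiv
  have hι := isConformalEquiv_involution hp
  obtain ⟨ω, hω, hrot⟩ := ((hι.trans hτ).trans hι).exists_rotation
    (by simp [involution_zero, hfix, involution_self])
  refine ⟨_, (isSemiflow_rotation ω.arg).isSemigroup hι, 1, fun z hz => ?_⟩
  have h1 := hrot _ (hι.mapsTo hz)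
  simp only [Function.comp_apply] at h1 ⊢
  rw [hι.leftInvOn hz] at h1
  have h2 : Complex.exp (((1 : ℝ≥0) * ω.arg : ℝ) * Complex.I) = ω := by
    have := Complex.norm_mul_exp_arg_mul_I ω
    rw [hω, Complex.ofReal_one, one_mul] at this
    simpa using this
  rw [h2, ← h1]
  exact hι.leftInvOn (hτ.mapsTo hz)

/-- The half-turn is reached at time `1` by rotating in either direction. -/
theorem exists_isElliptic_two_semigroups :
    ∃ φ : ℂ → ℂ, IsDiskAut φ ∧ IsElliptic φ ∧ ∃ s : ℝ≥0, 0 < s ∧ ∃ g h : ℝ≥0 → ℂ → ℂ,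
      IsSemigroup g ∧ IsSemigroup h ∧ EqOn (g s) φ disk ∧ EqOn (h s) φ disk ∧
      ∃ t, ¬ EqOn (g t) (h t) disk := by
  have hid : IsConformalEquiv disk disk id id :=
    ⟨differentiableOn_id, differentiableOn_id, mapsTo_id _, mapsTo_id _, fun _ _ => rfl,
      fun _ _ => rfl⟩
  have hhalf : (1 / 2 : ℂ) ∈ disk := by rw [mem_disk]; norm_num
  have haut := (isConformalEquiv_mul (ω := -1) (by simp)).isDiskAut
  refine ⟨_, haut, ⟨haut.isSelfMap, fun h => ?_, 0, zero_mem_disk, by simp⟩, 1, one_pos, _, _,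
    (isSemiflow_rotation Real.pi).isSemigroup hid, (isSemiflow_rotation (-Real.pi)).isSemigroup hid,
    fun z _ => ?_, fun z _ => ?_, 1 / 2, fun h => ?_⟩
  · have := h hhalf
    norm_num at this
  · simp [Complex.exp_pi_mul_I]
  · simp [Complex.exp_neg, Complex.exp_pi_mul_I]
  · have h1 := h hhalf
    have e1 : Complex.exp (Real.pi / 2 * Complex.I) = Complex.I := Complex.exp_pi_div_two_mul_I
    have e2 : Complex.exp (((1 / 2 : ℝ≥0) * Real.pi : ℝ) * Complex.I) = Complex.I := by
      refine Eq.trans ?_ e1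
      congr 1; push_cast; ring
    have e3 : Complex.exp (((1 / 2 : ℝ≥0) * -Real.pi : ℝ) * Complex.I) = Complex.I⁻¹ := by
      refine Eq.trans ?_ (congrArg Inv.inv e1)
      rw [← Complex.exp_neg]; congr 1; push_cast; ring
    simp only [Function.comp_apply, id] at h1
    rw [e2, e3] at h1
    have := congrArg Complex.im h1
    norm_num at this

/-! ### Normal forms of linear fractional maps fixing the origin -/

/-- The condition `|A| + |C| ≤ 1` says that `A z / (C z + 1)` is a self-map of the disk without pole
there. -/
theorem norm_add_norm_le_one_iff {A C : ℂ} :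
    ‖A‖ + ‖C‖ ≤ 1 ↔ ∀ z ∈ disk, ‖A * z‖ < ‖C * z + 1‖ := by
  constructor
  · intro h z hz
    rw [mem_disk] at hz
    have h1 : 1 - ‖C‖ * ‖z‖ ≤ ‖C * z + 1‖ := by
      have := norm_sub_le (C * z + 1) (C * z)
      rw [add_sub_cancel_left, norm_one, norm_mul] at this
      linarith
    rw [norm_mul]
    nlinarith [norm_nonneg A, norm_nonneg C, norm_nonneg z]
  · intro h
    -- the extremal points are those where `C * z` is a negative real number
    have key : ∀ r : ℝ, 0 ≤ r → r < 1 → ‖A‖ * r < |1 - ‖C‖ * r| := by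
      intro r hr hr1
      obtain ⟨u, hu, hCu⟩ : ∃ u : ℂ, ‖u‖ = 1 ∧ C * u = ‖C‖ := by
        rcases eq_or_ne C 0 with rfl | hC
        · exact ⟨1, by simp⟩
        · have hC' : (‖C‖ : ℂ) ≠ 0 := Complex.ofReal_ne_zero.2 (norm_ne_zero_iff.2 hC)
          refine ⟨‖C‖ / C, by simp [hC], mul_div_cancel₀ _ hC⟩
      have h1 : ‖-(r : ℂ) * u‖ = r := by
        rw [norm_mul, norm_neg, hu, Complex.norm_real, Real.norm_of_nonneg hr, mul_one]
      have h2 := h (-(r : ℂ) * u) (mem_disk.2 (by rwa [h1]))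
      rw [norm_mul, h1, show C * (-(r : ℂ) * u) + 1 = ((1 - ‖C‖ * r : ℝ) : ℂ) by
        push_cast; linear_combination -(r : ℂ) * hCu, Complex.norm_real] at h2
      exact h2
    have hC : ‖C‖ ≤ 1 := by
      by_contra hC
      push Not at hC
      have h1 := key ‖C‖⁻¹ (by positivity) (inv_lt_one_of_one_lt₀ hC)
      rw [mul_inv_cancel₀ (by linarith), sub_self, abs_zero] at h1
      exact absurd h1 (not_lt.2 (by positivity))
    by_contra hs
    push Not at hs
    have hs0 : 0 < ‖A‖ + ‖C‖ := by linarith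
    have hr1 : (‖A‖ + ‖C‖)⁻¹ < 1 := inv_lt_one_of_one_lt₀ hs
    have hr0 : 0 < (‖A‖ + ‖C‖)⁻¹ := inv_pos.2 hs0
    have h1 := key _ hr0.le hr1
    rw [abs_of_nonneg (by nlinarith [norm_nonneg C])] at h1
    have h2 := mul_inv_cancel₀ hs0.ne'
    linarith

theorem mul_add_one_ne_zero {A C : ℂ} (h : ‖A‖ + ‖C‖ ≤ 1) {z : ℂ} (hz : z ∈ disk) :
    C * z + 1 ≠ 0 :=
  norm_pos_iff.1 ((norm_nonneg _).trans_lt (norm_add_norm_le_one_iff.1 h z hz))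

theorem mapsTo_normalForm {A C : ℂ} (h : ‖A‖ + ‖C‖ ≤ 1) : MapsTo (normalForm A C) disk disk := by
  intro z hz
  rw [mem_disk, normalForm, norm_div, div_lt_one (norm_pos_iff.2 (mul_add_one_ne_zero h hz))]
  exact norm_add_norm_le_one_iff.1 h z hz

/-- Conjugation by the involution at the fixed point `p` gives a linear fractional map fixing `0`,
whose coefficients are computed from `a p + b = p (c p + d)`; the bound on them is the self-map
property. -/
theorem exists_normalForm {φ : ℂ → ℂ} (hφ : IsSelfMap φ) (hL : IsLFT φ)
    (hid : ¬ EqOn φ id disk) {p : ℂ} (hp : p ∈ disk) (hfix : φ p = p) :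
    ∃ A C : ℂ, ‖A‖ + ‖C‖ ≤ 1 ∧ A ≠ 1 ∧
      EqOn (involution p ∘ φ ∘ involution p) (normalForm A C) disk := by
  obtain ⟨a, b, c, d, -, hf⟩ := hL
  have hι := isConformalEquiv_involution hp
  obtain ⟨hD, hfp⟩ := hf p hp
  rw [hfix, eq_div_iff hD] at hfp
  have hG : (c * p + d) * (1 - conj p * p) ≠ 0 :=
    mul_ne_zero hD (one_sub_conj_mul_ne_zero hp hp)
  have hform : ∀ z ∈ disk, ((conj p * (a + b * conj p) - (c + d * conj p)) /
      ((c * p + d) * (1 - conj p * p))) * z + 1 ≠ 0 ∧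
      (involution p ∘ φ ∘ involution p) z = normalForm
        (((a + b * conj p) - p * (c + d * conj p)) / ((c * p + d) * (1 - conj p * p)))
        ((conj p * (a + b * conj p) - (c + d * conj p)) / ((c * p + d) * (1 - conj p * p))) z := by
    intro z hz
    have h1 := one_sub_conj_mul_ne_zero hp hz
    obtain ⟨h2, h3⟩ := hf _ (hι.mapsTo hz)
    have h4 := one_sub_conj_mul_ne_zero hp (hφ.mapsTo (hι.mapsTo hz))
    have e1 : involution p z * (1 - conj p * z) = p - z := div_mul_cancel₀ _ h1
    rw [eq_div_iff h2] at h3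
    have e2 : (1 - conj p * φ (involution p z)) * (c * involution p z + d) * (1 - conj p * z) =
        (c * p + d) * (1 - conj p * p) + (conj p * (a + b * conj p) - (c + d * conj p)) * z := by
      linear_combination (c - conj p * a) * e1 - conj p * (1 - conj p * z) * h3 + conj p * hfp
    have e3 : (p - φ (involution p z)) * (c * involution p z + d) * (1 - conj p * z) =
        ((a + b * conj p) - p * (c + d * conj p)) * z := by
      linear_combination (p * c - a) * e1 - (1 - conj p * z) * h3 + hfp
    have h5 := mul_ne_zero (mul_ne_zero h4 h2) h1
    have h6 : ((conj p * (a + b * conj p) - (c + d * conj p)) /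
      ((c * p + d) * (1 - conj p * p))) * z + 1 ≠ 0 := by
      rw [div_mul_eq_mul_div, div_add_one hG]
      refine div_ne_zero ?_ hG
      rw [add_comm, ← e2]
      exact h5
    refine ⟨h6, ?_⟩
    simp only [Function.comp_apply]
    rw [involution, normalForm, div_mul_eq_mul_div, div_mul_eq_mul_div, div_add_one hG,
      div_div_div_cancel_right₀ hG, add_comm (_ * z), ← e2, ← e3, mul_div_mul_right _ _ h1,
      mul_div_mul_right _ _ h2]
  generalize (conj p * (a + b * conj p) - (c + d * conj p)) /
    ((c * p + d) * (1 - conj p * p)) = C at hform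
  generalize ((a + b * conj p) - p * (c + d * conj p)) /
    ((c * p + d) * (1 - conj p * p)) = A at hform
  have hAC : ‖A‖ + ‖C‖ ≤ 1 := by
    refine norm_add_norm_le_one_iff.2 fun z hz => ?_
    obtain ⟨h1, h2⟩ := hform z hz
    have h3 := hι.mapsTo (hφ.mapsTo (hι.mapsTo hz))
    simp only [Function.comp_apply] at h2
    rwa [h2, mem_disk, normalForm, norm_div, div_lt_one (norm_pos_iff.2 h1)] at h3
  refine ⟨A, C, hAC, ?_, fun z hz => (hform z hz).2⟩
  rintro rfl
  have hC : C = 0 := by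
    rw [norm_one] at hAC
    exact norm_le_zero_iff.1 (by linarith)
  refine hid fun z hz => ?_
  have h1 := (hform _ (hι.mapsTo hz)).2
  simp only [Function.comp_apply] at h1
  rw [hι.leftInvOn hz, hC, normalForm, zero_mul, zero_add, div_one, one_mul] at h1
  exact hι.bijOn.injOn (hφ.mapsTo hz) hz h1

/-! ### Self-maps commuting with a normal form -/

section Koenigs

variable {A C k : ℂ}

theorem norm_le_one_of_norm_add_norm_le (hA : A ≠ 1) (hAC : ‖A‖ + ‖C‖ ≤ 1)
    (hk : k * (1 - A) = C) : ‖k‖ ≤ 1 := by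
  have h1 : 0 < ‖1 - A‖ := norm_pos_iff.2 (sub_ne_zero.2 hA.symm)
  have h2 := congrArg norm hk
  rw [norm_mul] at h2
  have h3 := norm_sub_norm_le 1 A
  rw [norm_one] at h3
  refine le_of_mul_le_mul_right ?_ h1
  linarith

theorem one_add_mul_ne_zero (hk : ‖k‖ ≤ 1) {z : ℂ} (hz : z ∈ disk) : 1 + k * z ≠ 0 := by
  rw [add_comm]
  exact mul_add_one_ne_zero (A := 0) (by simpa using hk) hz

/-- The map `z / (1 + k z)` linearizes the normal form, where `k = C / (1 - A)`. -/
theorem koenigs_normalForm (hA : A ≠ 1) (hAC : ‖A‖ + ‖C‖ ≤ 1) (hk : k * (1 - A) = C) {z : ℂ}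
    (hz : z ∈ disk) :
    normalForm A C z / (1 + k * normalForm A C z) = A * (z / (1 + k * z)) := by
  have hk1 := norm_le_one_of_norm_add_norm_le hA hAC hk
  have h1 := one_add_mul_ne_zero hk1 hz
  have h2 := one_add_mul_ne_zero hk1 (mapsTo_normalForm hAC hz)
  have h3 := mul_add_one_ne_zero hAC hz
  have h4 : normalForm A C z * (C * z + 1) = A * z := div_mul_cancel₀ _ h3
  rw [← mul_div_assoc, div_eq_div_iff h2 h1]
  refine mul_right_cancel₀ h3 ?_
  linear_combination (1 + k * z - k * A * z) * h4 + A * z ^ 2 * hk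

theorem eq_zero_of_normalForm_eq (hA : ‖A‖ < 1) (hAC : ‖A‖ + ‖C‖ ≤ 1) {z : ℂ} (hz : z ∈ disk)
    (h : normalForm A C z = z) : z = 0 := by
  rw [normalForm, div_eq_iff (mul_add_one_ne_zero hAC hz)] at h
  by_contra hz0
  have h1 : A - 1 = C * z := mul_left_cancel₀ hz0 (by linear_combination h)
  have h2 := norm_sub_norm_le 1 A
  rw [norm_one, norm_sub_rev, h1, norm_mul] at h2
  rw [mem_disk] at hz
  nlinarith [norm_nonneg C, norm_nonneg z]

/-- A self-map commuting with a normal form is linearized by the same map `κ`: the quotient `κ (h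
z) / κ z` is invariant under the normal form, whose iterates tend to `0`, so it equals its limit
`h' 0` there. -/
theorem koenigs_of_commute (hA0 : A ≠ 0) (hA : ‖A‖ < 1) (hAC : ‖A‖ + ‖C‖ ≤ 1)
    (hk : k * (1 - A) = C) {h : ℂ → ℂ} (hd : DifferentiableOn ℂ h disk) (hm : MapsTo h disk disk)
    (hcomm : ∀ z ∈ disk, h (normalForm A C z) = normalForm A C (h z)) :
    h 0 = 0 ∧ ∀ z ∈ disk, h z * (1 + k * (1 - deriv h 0) * z) = deriv h 0 * z := by
  have hA1 : A ≠ 1 := by rintro rfl; simp at hA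
  have hk1 := norm_le_one_of_norm_add_norm_le hA1 hAC hk
  have h0 : h 0 = 0 := by
    have := hcomm 0 zero_mem_disk
    simp only [normalForm, mul_zero, zero_div] at this
    exact eq_zero_of_normalForm_eq hA hAC (hm zero_mem_disk) this.symm
  refine ⟨h0, fun z hz => ?_⟩
  rcases eq_or_ne z 0 with rfl | hz0
  · simp [h0]
  set κ : ℂ → ℂ := fun z => z / (1 + k * z) with hκ
  have hiter : ∀ n : ℕ, (normalForm A C)^[n] z ∈ disk ∧
      κ ((normalForm A C)^[n] z) = A ^ n * κ z ∧
      h ((normalForm A C)^[n] z) = (normalForm A C)^[n] (h z) ∧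
      (normalForm A C)^[n] (h z) ∈ disk ∧
      κ ((normalForm A C)^[n] (h z)) = A ^ n * κ (h z) := by
    intro n
    induction n with
    | zero => simp [hz, hm hz]
    | succ n ih =>
      obtain ⟨i1, i2, i3, i4, i5⟩ := ih
      simp only [Function.iterate_succ_apply']
      refine ⟨mapsTo_normalForm hAC i1, ?_, by rw [hcomm _ i1, i3], mapsTo_normalForm hAC i4, ?_⟩
      · rw [hκ]
        simp only
        rw [koenigs_normalForm hA1 hAC hk i1, pow_succ', mul_assoc, ← i2]
      · rw [hκ]
        simp only
        rw [koenigs_normalForm hA1 hAC hk i4, pow_succ', mul_assoc, ← i5]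
  have hκ0 : ∀ w ∈ disk, w ≠ 0 → κ w ≠ 0 := fun w hw hw0 =>
    div_ne_zero hw0 (one_add_mul_ne_zero hk1 hw)
  have hne : ∀ n, (normalForm A C)^[n] z ≠ 0 := by
    intro n hn
    have := (hiter n).2.1
    rw [hn] at this
    refine mul_ne_zero (pow_ne_zero n hA0) (hκ0 z hz hz0) ?_
    rw [← this]
    simp [hκ]
  have hAn : Tendsto (fun n : ℕ => A ^ n * κ z) atTop (𝓝 0) := by
    simpa using (tendsto_pow_atTop_nhds_zero_of_norm_lt_one hA).mul_const (κ z)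
  have hlim0 : Tendsto (fun n => (normalForm A C)^[n] z) atTop (𝓝 0) := by
    have h1 : Tendsto (fun n : ℕ => (A ^ n * κ z) / (1 - k * (A ^ n * κ z))) atTop (𝓝 0) := by
      simpa only [mul_zero, sub_zero, zero_div, Pi.div_def] using
        hAn.div (tendsto_const_nhds (x := (1 : ℂ)).sub (hAn.const_mul k)) (by simp)
    refine h1.congr fun n => ?_
    rw [← (hiter n).2.1, hκ]
    have := one_add_mul_ne_zero hk1 (hiter n).1
    simp only
    rw [mul_div_assoc', one_sub_div this, div_div_div_cancel_right₀ this, add_sub_cancel_right,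
      div_one]
  have hlim : Tendsto (fun n => (normalForm A C)^[n] z) atTop (𝓝[≠] 0) :=
    tendsto_nhdsWithin_iff.2 ⟨hlim0, Eventually.of_forall hne⟩
  have hdh : DifferentiableAt ℂ h 0 := hd.differentiableAt (isOpen_disk.mem_nhds zero_mem_disk)
  have hquot : Tendsto (fun w => (h w / w) * ((1 + k * w) / (1 + k * h w))) (𝓝[≠] 0)
      (𝓝 (deriv h 0)) := by
    have h1 : Tendsto (fun w => h w / w) (𝓝[≠] 0) (𝓝 (deriv h 0)) := by
      refine hdh.hasDerivAt.tendsto_slope.congr fun w => ?_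
      rw [slope_def_field, h0, sub_zero, sub_zero]
    have h2 : Tendsto (fun w : ℂ => w) (𝓝[≠] 0) (𝓝 0) := nhdsWithin_le_nhds
    have h3 : Tendsto h (𝓝[≠] 0) (𝓝 0) := by
      have := hdh.continuousAt.tendsto
      rw [h0] at this
      exact this.mono_left nhdsWithin_le_nhds
    have h4 := (((h2.const_mul k).const_add 1).div ((h3.const_mul k).const_add 1) (by simp))
    simpa using h1.mul h4
  have hconst : κ (h z) / κ z = deriv h 0 := by
    refine tendsto_nhds_unique (tendsto_const_nhds.congr fun n => ?_) (hquot.comp hlim)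
    obtain ⟨i1, i2, i3, i4, i5⟩ := hiter n
    simp only [Function.comp_apply]
    have e : ∀ x y : ℂ, x / y * ((1 + k * y) / (1 + k * x)) = κ x / κ y := fun x y => by
      rw [hκ, div_mul_div_comm, mul_comm y, ← div_div_div_eq]
    rw [e, i3, i5, i2, mul_div_mul_left _ _ (pow_ne_zero n hA0)]
  have h1 := one_add_mul_ne_zero hk1 hz
  have h2 := one_add_mul_ne_zero hk1 (hm hz)
  rw [div_eq_iff (hκ0 z hz hz0), hκ] at hconst
  simp only at hconst
  rw [← mul_div_assoc, div_eq_div_iff h2 h1] at hconst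
  linear_combination hconst

theorem norm_add_norm_le_one_of_commute (hA0 : A ≠ 0) (hA : ‖A‖ < 1) (hAC : ‖A‖ + ‖C‖ ≤ 1)
    (hk : k * (1 - A) = C) {h : ℂ → ℂ} (hd : DifferentiableOn ℂ h disk) (hm : MapsTo h disk disk)
    (hcomm : ∀ z ∈ disk, h (normalForm A C z) = normalForm A C (h z)) :
    ‖deriv h 0‖ + ‖k * (1 - deriv h 0)‖ ≤ 1 := by
  have hA1 : A ≠ 1 := by rintro rfl; simp at hA
  have hk1 := norm_le_one_of_norm_add_norm_le hA1 hAC hk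
  have hform := (koenigs_of_commute hA0 hA hAC hk hd hm hcomm).2
  refine norm_add_norm_le_one_iff.2 fun z hz => ?_
  have h1 := hform z hz
  have h2 : k * (1 - deriv h 0) * z + 1 ≠ 0 := by
    intro h2
    rw [add_comm, h2, mul_zero, eq_comm, mul_eq_zero] at h1
    rcases h1 with h1 | h1
    · rw [h1, sub_zero, mul_one, add_comm] at h2
      exact one_add_mul_ne_zero hk1 hz h2
    · simp [h1] at h2
  rw [← h1, norm_mul, add_comm 1]
  exact mul_lt_of_lt_one_left (norm_pos_iff.2 h2) (mem_disk.1 (hm hz))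

end Koenigs

/-! ### Successive square roots -/

/-- The region `|k| |1 - z| ≤ 1 - |z|` is closed under multiplication. -/
theorem mul_norm_one_sub_le {K : ℝ} {z w : ℂ} (hz : K * ‖1 - z‖ ≤ 1 - ‖z‖)
    (hw : K * ‖1 - w‖ ≤ 1 - ‖w‖) (hK : 0 ≤ K) : K * ‖1 - z * w‖ ≤ 1 - ‖z * w‖ := by
  have h1 : ‖1 - z * w‖ ≤ ‖1 - z‖ + ‖z‖ * ‖1 - w‖ := by
    rw [← norm_mul]
    refine le_trans (le_of_eq ?_) (norm_add_le _ _)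
    congr 1
    ring
  rw [norm_mul]
  have h2 := mul_le_mul_of_nonneg_left h1 hK
  have h3 := mul_le_mul_of_nonneg_left hw (norm_nonneg z)
  linarith

theorem pow_two_pow_of_sq {a : ℕ → ℂ} (ha : ∀ n, a (n + 1) ^ 2 = a n) (n : ℕ) :
    a n ^ 2 ^ n = a 0 := by
  induction n with
  | zero => simp
  | succ n ih => rw [pow_succ', pow_mul, ha, ih]

/-- Successive square roots in the region `K |1 - z| ≤ 1 - |z|` tend to its vertex `1`, so that
from some index on they are principal roots, hence the values at `t = 2⁻ⁿ` of one exponential `exp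
(t μ)`. The powers of the roots are then the values at all dyadic `t`. -/
theorem exists_exp_of_square_roots {K : ℝ} (hK : 0 ≤ K) {a : ℕ → ℂ} (ha0 : a 0 ≠ 0)
    (ha : ∀ n, a (n + 1) ^ 2 = a n) (hS : ∀ n, K * ‖1 - a n‖ ≤ 1 - ‖a n‖) :
    ∃ μ : ℂ, Complex.exp μ = a 0 ∧
      ∀ t : ℝ, 0 ≤ t → K * ‖1 - Complex.exp (t * μ)‖ ≤ 1 - ‖Complex.exp (t * μ)‖ := by
  have hne : ∀ n, a n ≠ 0 := fun n h => ha0 (by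
    rw [← pow_two_pow_of_sq ha n, h, zero_pow (by positivity)])
  rcases hK.eq_or_lt with rfl | hK
  · refine ⟨Complex.log (a 0), Complex.exp_log ha0, fun t ht => ?_⟩
    rw [zero_mul, sub_nonneg, Complex.norm_exp, Complex.re_ofReal_mul, Complex.log_re,
      Real.exp_le_one_iff]
    have := hS 0
    rw [zero_mul, sub_nonneg] at this
    exact mul_nonpos_of_nonneg_of_nonpos ht (Real.log_nonpos (norm_nonneg _) this)
  have hnorm : ∀ n : ℕ, ‖a n‖ = Real.exp (Real.log ‖a 0‖ * ((2 : ℝ)⁻¹) ^ n) := by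
    intro n
    rw [← pow_two_pow_of_sq ha n, norm_pow, Real.log_pow, inv_pow, Nat.cast_pow, Nat.cast_ofNat,
      mul_right_comm, mul_inv_cancel₀ (by positivity), one_mul,
      Real.exp_log (norm_pos_iff.2 (hne n))]
  have hlimn : Tendsto (fun n => ‖a n‖) atTop (𝓝 1) := by
    rw [show (fun n => ‖a n‖) = _ from funext hnorm]
    have h1 : Tendsto (fun n : ℕ => ((2 : ℝ)⁻¹) ^ n) atTop (𝓝 0) :=
      tendsto_pow_atTop_nhds_zero_of_lt_one (by norm_num) (by norm_num)
    simpa [Function.comp_def] using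
      (Real.continuous_exp.tendsto _).comp (h1.const_mul (Real.log ‖a 0‖))
  have hev : ∀ᶠ n in atTop, ‖1 - a n‖ < 1 := by
    have h1 := hlimn.eventually (lt_mem_nhds (show 1 - K < 1 by linarith))
    filter_upwards [h1] with n hn
    have := hS n
    by_contra h
    push Not at h
    nlinarith
  obtain ⟨N, hN⟩ := eventually_atTop.1 hev
  have harg : ∀ n, N ≤ n → |(a n).arg| < Real.pi / 2 := by
    intro n hn
    refine Complex.abs_arg_lt_pi_div_two_iff.2 (Or.inl ?_)
    have h1 := (Complex.re_le_norm (1 - a n)).trans_lt (hN n hn)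
    simpa using h1
  have hlog : ∀ m : ℕ, (2 : ℂ) ^ m * Complex.log (a (N + m)) = Complex.log (a N) := by
    intro m
    induction m with
    | zero => simp
    | succ m ih =>
      have h1 := abs_lt.1 (harg (N + (m + 1)) (by omega))
      have h2 : Complex.log (a (N + m)) = 2 * Complex.log (a (N + (m + 1))) := by
        have h3 : (2 * Complex.log (a (N + (m + 1)))).im = 2 * (a (N + (m + 1))).arg := by
          simp [Complex.log_im]
        rw [← ha (N + m), ← Complex.log_exp (x := 2 * Complex.log (a (N + (m + 1))))
          (by rw [h3]; linarith [h1.1]) (by rw [h3]; linarith [h1.2]), two_mul, Complex.exp_add,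
          Complex.exp_log (hne _), ← sq, add_assoc]
      rw [← ih, h2, pow_succ]
      ring
  have hexp : ∀ m : ℕ, Complex.exp (((2 : ℝ) ^ (N + m))⁻¹ * (2 ^ N * Complex.log (a N))) =
      a (N + m) := by
    intro m
    rw [← hlog m, ← mul_assoc (2 ^ N), ← pow_add]
    push_cast
    rw [inv_mul_cancel_left₀ (pow_ne_zero _ two_ne_zero), Complex.exp_log (hne _)]
  refine ⟨2 ^ N * Complex.log (a N), ?_, fun t ht => ?_⟩
  · rw [← pow_two_pow_of_sq ha N]
    have := Complex.exp_nat_mul (Complex.log (a N)) (2 ^ N)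
    rw [Complex.exp_log (hne N)] at this
    rw [← this]
    push_cast
    rfl
  have hdyadic : ∀ m j : ℕ, K * ‖1 - a m ^ j‖ ≤ 1 - ‖a m ^ j‖ := by
    intro m j
    induction j with
    | zero => simp
    | succ j ih =>
      rw [pow_succ]
      exact mul_norm_one_sub_le ih (hS m) hK.le
  have htend : Tendsto (fun m : ℕ => (⌊t * 2 ^ (N + m)⌋₊ : ℝ) / 2 ^ (N + m)) atTop (𝓝 t) := by
    refine (tendsto_nat_floor_mul_div_atTop ht).comp ?_
    exact (tendsto_pow_atTop_atTop_of_one_lt one_lt_two).comp (tendsto_add_atTop_nat N |>.congr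
      fun m => add_comm m N)
  have hc1 : Continuous fun t : ℝ =>
      K * ‖1 - Complex.exp (t * (2 ^ N * Complex.log (a N)))‖ := by fun_prop
  have hc2 : Continuous fun t : ℝ =>
      1 - ‖Complex.exp (t * (2 ^ N * Complex.log (a N)))‖ := by fun_prop
  refine le_of_tendsto_of_tendsto' ((hc1.tendsto t).comp htend) ((hc2.tendsto t).comp htend)
    fun m => ?_
  have e := Complex.exp_nat_mul (((2 : ℝ) ^ (N + m))⁻¹ * (2 ^ N * Complex.log (a N)))
    ⌊t * 2 ^ (N + m)⌋₊
  rw [hexp, ← mul_assoc] at e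
  have e2 : (((⌊t * 2 ^ (N + m)⌋₊ : ℝ) / 2 ^ (N + m) : ℝ) : ℂ) =
      (⌊t * 2 ^ (N + m)⌋₊ : ℂ) * (((2 : ℝ) ^ (N + m))⁻¹ : ℝ) := by
    push_cast
    rw [div_eq_mul_inv]
  simp only [Function.comp_apply]
  rw [e2]
  push_cast at e ⊢
  rw [e]
  exact hdyadic _ _

/-- The flow whose time-`t` map is the normal form with multiplier `exp (t μ)` linearized by
`z / (1 + k z)`. -/
theorem isSemiflow_normalForm {k μ : ℂ}
    (h : ∀ t : ℝ, 0 ≤ t → ‖k‖ * ‖1 - Complex.exp (t * μ)‖ ≤ 1 - ‖Complex.exp (t * μ)‖) :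
    IsSemiflow disk (fun t => normalForm (Complex.exp ((t : ℝ) * μ))
      (k * (1 - Complex.exp ((t : ℝ) * μ)))) := by
  have hb : ∀ t : ℝ≥0, ‖Complex.exp ((t : ℝ) * μ)‖ + ‖k * (1 - Complex.exp ((t : ℝ) * μ))‖ ≤ 1 := by
    intro t
    rw [norm_mul]
    linarith [h t t.coe_nonneg]
  have hne : ∀ t : ℝ≥0, ∀ z ∈ disk, k * (1 - Complex.exp ((t : ℝ) * μ)) * z + 1 ≠ 0 :=
    fun t z hz => mul_add_one_ne_zero (hb t) hz
  refine ⟨fun t => ?_, fun t => mapsTo_normalForm (hb t), fun z _ => ?_, fun s t z hz => ?_, ?_⟩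
  · unfold normalForm
    exact DifferentiableOn.div (by fun_prop) (by fun_prop) (hne t)
  · simp [normalForm]
  · have h1 := hne t z hz
    have h2 := hne s _ (mapsTo_normalForm (hb t) hz)
    have h3 := hne (s + t) z hz
    have e1 : Complex.exp (((s + t : ℝ≥0) : ℝ) * μ) =
        Complex.exp ((s : ℝ) * μ) * Complex.exp ((t : ℝ) * μ) := by
      rw [← Complex.exp_add]
      congr 1
      push_cast
      ring
    rw [e1] at h3
    simp only [Function.comp_apply, e1]
    generalize Complex.exp ((s : ℝ) * μ) = x at *
    generalize Complex.exp ((t : ℝ) * μ) = y at *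
    have e2 : normalForm y (k * (1 - y)) z * (k * (1 - y) * z + 1) = y * z := div_mul_cancel₀ _ h1
    generalize normalForm y (k * (1 - y)) z = w at *
    rw [normalForm, normalForm, div_eq_div_iff h2 h3]
    linear_combination x * e2
  · have : ContinuousOn (fun q : ℝ≥0 × ℂ => Complex.exp ((q.1 : ℝ) * μ) * q.2 /
        (k * (1 - Complex.exp ((q.1 : ℝ) * μ)) * q.2 + 1)) (univ ×ˢ disk) := by
      refine ContinuousOn.div (Continuous.continuousOn ?_) (Continuous.continuousOn ?_)
        fun q hq => hne q.1 q.2 hq.2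
      · fun_prop
      · fun_prop
    exact this

/-! ### Embedding elliptic maps into semigroups -/

section Elliptic

variable {φ σ τ : ℂ → ℂ} {A C : ℂ}

/-- A linear fractional map that is not an automorphism has a multiplier `A` with `0 < |A| < 1`:
it is injective, and for `|A| = 1` the bound on the coefficients forces `C = 0`. -/
theorem multiplier_bounds (hφ : IsSelfMap φ) (hL : IsLFT φ) (haut : ¬ IsDiskAut φ)
    (hAC : ‖A‖ + ‖C‖ ≤ 1) (hσ : IsConformalEquiv disk disk σ τ)
    (hconj : EqOn (σ ∘ φ) (normalForm A C ∘ σ) disk) : A ≠ 0 ∧ ‖A‖ < 1 := by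
  constructor
  · rintro rfl
    have hhalf : (1 / 2 : ℂ) ∈ disk := by rw [mem_disk]; norm_num
    have h0 : ∀ z ∈ disk, σ (φ z) = 0 := fun z hz => by
      have := hconj hz
      simpa [normalForm] using this
    have heq : φ 0 = φ (1 / 2) := hσ.bijOn.injOn (hφ.mapsTo zero_mem_disk) (hφ.mapsTo hhalf)
      ((h0 _ zero_mem_disk).trans (h0 _ hhalf).symm)
    obtain ⟨a, b, c, d, hdet, hf⟩ := hL
    obtain ⟨h1, h2⟩ := hf 0 zero_mem_disk
    obtain ⟨h3, h4⟩ := hf _ hhalf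
    rw [h2, h4, div_eq_div_iff h1 h3] at heq
    exact hdet (by linear_combination -2 * heq)
  · refine lt_of_le_of_ne (by linarith [norm_nonneg C]) fun hA => haut ?_
    have hC : C = 0 := norm_le_zero_iff.1 (by linarith)
    have he := (hσ.trans (isConformalEquiv_mul hA)).trans hσ.symm
    refine ⟨hφ, he.bijOn.congr fun z hz => ?_⟩
    have h1 := hconj hz
    simp only [Function.comp_apply, normalForm, hC, zero_mul, zero_add, div_one] at h1 ⊢
    rw [← h1, hσ.leftInvOn (hφ.mapsTo hz)]

theorem hasDerivAt_normalForm_zero (A C : ℂ) : HasDerivAt (normalForm A C) A 0 := by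
  have h1 : HasDerivAt (fun z : ℂ => A * z) A 0 := by
    simpa using (hasDerivAt_id (0 : ℂ)).const_mul A
  have h2 : HasDerivAt (fun z : ℂ => C * z + 1) C 0 := by
    simpa using ((hasDerivAt_id (0 : ℂ)).const_mul C).add_const 1
  simpa [normalForm] using! h1.div h2 (by simp)

/-- The multipliers of `g (t / 2ⁿ)` are the required successive square roots. -/
theorem exists_square_roots_of_belongsToSemigroup (hA0 : A ≠ 0) (hA : ‖A‖ < 1)
    (hAC : ‖A‖ + ‖C‖ ≤ 1) (hσ : IsConformalEquiv disk disk σ τ)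
    (hconj : EqOn (σ ∘ φ) (normalForm A C ∘ σ) disk) (hs : BelongsToSemigroup φ) :
    ∃ a : ℕ → ℂ, a 0 = A ∧ (∀ n, a (n + 1) ^ 2 = a n) ∧ ∀ n, a n ∈ stolzRegion A C := by
  obtain ⟨g, hg, t, hgt⟩ := hs
  have hA1 : A ≠ 1 := by rintro rfl; simp at hA
  have hA1' : 1 - A ≠ 0 := sub_ne_zero.2 hA1.symm
  have hk : C / (1 - A) * (1 - A) = C := div_mul_cancel₀ _ hA1'
  have hd : ∀ r, DifferentiableOn ℂ (σ ∘ g r ∘ τ) disk := fun r =>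
    hσ.differentiableOn.comp ((hg.isSelfMap r).differentiableOn.comp hσ.differentiableOn_inv
      hσ.mapsTo_inv) ((hg.isSelfMap r).mapsTo.comp hσ.mapsTo_inv)
  have hm : ∀ r, MapsTo (σ ∘ g r ∘ τ) disk disk := fun r =>
    hσ.mapsTo.comp ((hg.isSelfMap r).mapsTo.comp hσ.mapsTo_inv)
  have hadd : ∀ r s, ∀ z ∈ disk, (σ ∘ g r ∘ τ) ((σ ∘ g s ∘ τ) z) = (σ ∘ g (r + s) ∘ τ) z := by
    intro r s z hz
    have h1 := hg.add r s (hσ.mapsTo_inv hz)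
    simp only [Function.comp_apply] at h1 ⊢
    rw [hσ.leftInvOn ((hg.isSelfMap s).mapsTo (hσ.mapsTo_inv hz)), h1]
  have ht : ∀ z ∈ disk, (σ ∘ g t ∘ τ) z = normalForm A C z := by
    intro z hz
    have h1 := hconj (hσ.mapsTo_inv hz)
    simp only [Function.comp_apply] at h1 ⊢
    rw [hgt (hσ.mapsTo_inv hz), h1, hσ.rightInvOn hz]
  have hcomm : ∀ r, ∀ z ∈ disk,
      (σ ∘ g r ∘ τ) (normalForm A C z) = normalForm A C ((σ ∘ g r ∘ τ) z) := by
    intro r z hz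
    rw [← ht z hz, ← ht _ (hm r hz), hadd r t z hz, hadd t r z hz, add_comm]
  have h0 : ∀ r, (σ ∘ g r ∘ τ) 0 = 0 := fun r =>
    (koenigs_of_commute hA0 hA hAC hk (hd r) (hm r) (hcomm r)).1
  have hnhds : disk ∈ 𝓝 (0 : ℂ) := isOpen_disk.mem_nhds zero_mem_disk
  have hda : ∀ r, HasDerivAt (σ ∘ g r ∘ τ) (deriv (σ ∘ g r ∘ τ) 0) 0 := fun r =>
    ((hd r).differentiableAt hnhds).hasDerivAt
  have ha0 : deriv (σ ∘ g (t / 2 ^ 0) ∘ τ) 0 = A := by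
    rw [pow_zero, div_one]
    refine HasDerivAt.deriv ((hasDerivAt_normalForm_zero A C).congr_of_eventuallyEq ?_)
    filter_upwards [hnhds] with z hz using ht z hz
  have hsq : ∀ n : ℕ, deriv (σ ∘ g (t / 2 ^ (n + 1)) ∘ τ) 0 ^ 2 =
      deriv (σ ∘ g (t / 2 ^ n) ∘ τ) 0 := by
    intro n
    have e : t / 2 ^ (n + 1) + t / 2 ^ (n + 1) = t / 2 ^ n := by
      rw [← two_mul, pow_succ, ← div_div, mul_div_cancel₀ _ two_ne_zero]
    have h1 := hda (t / 2 ^ (n + 1))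
    have h2 : HasDerivAt (σ ∘ g (t / 2 ^ (n + 1)) ∘ τ)
        (deriv (σ ∘ g (t / 2 ^ (n + 1)) ∘ τ) 0) ((σ ∘ g (t / 2 ^ (n + 1)) ∘ τ) 0) := by
      rwa [h0]
    rw [sq]
    refine (HasDerivAt.deriv ((h2.comp 0 h1).congr_of_eventuallyEq ?_)).symm
    filter_upwards [hnhds] with z hz
    rw [← e]
    exact (hadd _ _ z hz).symm
  have hlt : ∀ n : ℕ, ‖deriv (σ ∘ g (t / 2 ^ n) ∘ τ) 0‖ < 1 := by
    intro n
    induction n with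
    | zero => rwa [ha0]
    | succ n ih =>
      rw [← hsq n, norm_pow] at ih
      exact (sq_lt_one_iff₀ (norm_nonneg _)).1 ih
  refine ⟨fun n => deriv (σ ∘ g (t / 2 ^ n) ∘ τ) 0, ha0, hsq, fun n => ⟨mem_disk.2 (hlt n), ?_⟩⟩
  have := norm_add_norm_le_one_of_commute hA0 hA hAC hk (hd (t / 2 ^ n)) (hm _) (hcomm _)
  rw [norm_mul, norm_div] at this
  linarith

theorem belongsToSemigroup_of_square_roots (hφ : IsSelfMap φ) (hA0 : A ≠ 0) (hA : ‖A‖ < 1)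
    (hσ : IsConformalEquiv disk disk σ τ)
    (hconj : EqOn (σ ∘ φ) (normalForm A C ∘ σ) disk) {a : ℕ → ℂ} (ha0 : a 0 = A)
    (ha : ∀ n, a (n + 1) ^ 2 = a n) (hS : ∀ n, a n ∈ stolzRegion A C) : BelongsToSemigroup φ := by
  have hA1' : 1 - A ≠ 0 := sub_ne_zero.2 (by rintro rfl; simp at hA)
  obtain ⟨μ, hμ, hb⟩ := exists_exp_of_square_roots (norm_nonneg (C / (1 - A))) (by rwa [ha0]) ha
    (fun n => by rw [norm_div]; exact (hS n).2)
  refine ⟨_, (isSemiflow_normalForm hb).isSemigroup hσ, 1, fun z hz => ?_⟩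
  have h1 := hconj hz
  simp only [Function.comp_apply] at h1 ⊢
  rw [NNReal.coe_one, Complex.ofReal_one, one_mul, hμ, ha0, div_mul_cancel₀ _ hA1', ← h1]
  exact hσ.leftInvOn (hφ.mapsTo hz)

end Elliptic

end DiskDynamics

theorem mainTheorem9 :
    -- (i), parabolic and hyperbolic maps: existence and uniqueness
    (∀ φ : ℂ → ℂ, DiskDynamics.IsSelfMap φ → DiskDynamics.IsLFT φ →
      (DiskDynamics.IsParabolic φ ∨ DiskDynamics.IsHyperbolic φ) → ∀ s : ℝ≥0, 0 < s →
      ∃ g : ℝ≥0 → ℂ → ℂ, DiskDynamics.IsSemigroup g ∧ EqOn (g s) φ DiskDynamics.disk ∧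
        ∀ h : ℝ≥0 → ℂ → ℂ, DiskDynamics.IsSemigroup h → EqOn (h s) φ DiskDynamics.disk →
          ∀ t, EqOn (h t) (g t) DiskDynamics.disk) ∧
    -- (i), elliptic automorphisms: existence
    (∀ φ : ℂ → ℂ, DiskDynamics.IsDiskAut φ → DiskDynamics.IsElliptic φ →
      DiskDynamics.BelongsToSemigroup φ) ∧
    -- (i), elliptic automorphisms: the semigroup need not be unique
    (∃ φ : ℂ → ℂ, DiskDynamics.IsDiskAut φ ∧ DiskDynamics.IsElliptic φ ∧
      ∃ s : ℝ≥0, 0 < s ∧ ∃ g h : ℝ≥0 → ℂ → ℂ,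
        DiskDynamics.IsSemigroup g ∧ DiskDynamics.IsSemigroup h ∧
        EqOn (g s) φ DiskDynamics.disk ∧ EqOn (h s) φ DiskDynamics.disk ∧
        ∃ t, ¬ EqOn (g t) (h t) DiskDynamics.disk) ∧
    -- (ii), elliptic maps that are not automorphisms
    (∀ φ : ℂ → ℂ, DiskDynamics.IsSelfMap φ → DiskDynamics.IsLFT φ →
      DiskDynamics.IsElliptic φ → ¬ DiskDynamics.IsDiskAut φ →
      -- conjugation by the involution at the fixed point gives the normal form
      (∀ p ∈ DiskDynamics.disk, φ p = p → ∃ A C : ℂ, ‖A‖ + ‖C‖ ≤ 1 ∧ A ≠ 1 ∧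
        EqOn (DiskDynamics.involution p ∘ φ ∘ DiskDynamics.involution p)
          (DiskDynamics.normalForm A C) DiskDynamics.disk) ∧
      -- the criterion, for every normal form to which the map is conjugate
      (∀ A C : ℂ, ‖A‖ + ‖C‖ ≤ 1 → ∀ σ : ℂ → ℂ, DiskDynamics.IsDiskAut σ →
        EqOn (σ ∘ φ) (DiskDynamics.normalForm A C ∘ σ) DiskDynamics.disk →
        (DiskDynamics.BelongsToSemigroup φ ↔
          ∃ a : ℕ → ℂ, a 0 = A ∧ (∀ n, a (n + 1) ^ 2 = a n) ∧
            ∀ n, a n ∈ DiskDynamics.stolzRegion A C))) := by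
  refine ⟨fun φ hφ hL h s hs => DiskDynamics.exists_unique_semigroup hφ hL h hs,
    fun φ hφ ⟨_, _, p, hp, hfix⟩ => DiskDynamics.belongsToSemigroup_of_isDiskAut hφ hp hfix,
    DiskDynamics.exists_isElliptic_two_semigroups, fun φ hφ hL hE haut =>
    ⟨fun p hp hfix => DiskDynamics.exists_normalForm hφ hL hE.2.1 hp hfix,
      fun A C hAC σ hσ hconj => ?_⟩⟩
  obtain ⟨τ, hτ⟩ := hσ.exists_isConformalEquiv
  obtain ⟨hA0, hA⟩ := DiskDynamics.multiplier_bounds hφ hL haut hAC hτ hconj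
  exact ⟨DiskDynamics.exists_square_roots_of_belongsToSemigroup hA0 hA hAC hτ hconj,
    fun ⟨a, ha0, ha, hS⟩ =>
      DiskDynamics.belongsToSemigroup_of_square_roots hφ hA0 hA hτ hconj ha0 ha hS⟩
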